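/- \textbf{Setting.} Let $d\ge 1$, let $\mathbb H$ be a separable complex Hilbert space with a fixed complete orthonormal system $\{e_j\}$, and let $\overline{x}=\sum_j\overline{\langle x,e_j\rangle}e_j$. Write $[x\otimes y](z)=\langle z,y\rangle x$, $\|A\|_{\rm tr}=\sum_j\langle (A^*A)^{1/2}e_j,e_j\rangle$, $\langle A,B\rangle_{\rm HS}={\rm trace}(A^*B)$, $\|A\|_{\rm HS}=\|A^*A\|_{\rm tr}^{1/2}$. Let $X=\{X(t),t\in\mathbb R^d\}$ be an $\mathbb H$-valued process that is real ($\overline{X(t)}=X(t)$ a.s.), has mean zero and finite second moments, and is second-order stationary, i.e. $\mathbb E[X(t)\otimes X(s)]$ and $\mathbb E[X(t)\otimes\overline{X(s)}]$ depend only on $t-s$. Let $C(h)=\mathbb E[X(h)\otimes X(0)]$. Let $B(0,\epsilon)$ be the open Euclidean ball. (C) $C$ is measurable, $\int\|C(h)\|_{\rm tr}\,dh<\infty$, and for some $0<\gamma\le1$ and $M<\infty$, $\int \sup_{\|y-x\|\le\delta}\|C(y)-C(x)\|_{\rm tr}\,dx\le M\delta^\gamma$ for all $\delta\in(0,1)$.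 Let $f(\theta)=(2\pi)^{-d}\int e^{\mathrm i h^\top\theta}C(h)\,dh$ be the spectral density. (V) $\mathbb E\|X(t)\|^4<\infty$ for all $t$. With ${\rm cum}(Y_1,Y_2,Y_3,Y_4)=\mathbb E\langle Y_1\otimes Y_2,Y_3\otimes Y_4\rangle_{\rm HS}-\langle\mathbb E[Y_1\otimes Y_2],\mathbb E[Y_3\otimes Y_4]\rangle_{\rm HS}-\mathbb E\langle Y_1,Y_3\rangle\,\mathbb E\langle Y_4,Y_2\rangle-\langle\mathbb E[Y_1\otimes\overline{Y_4}],\mathbb E[Y_3\otimes\overline{Y_2}]\rangle_{\rm HS}$, the quantity ${\rm cum}(X(t+\tau),X(s+\tau),X(w+\tau),X(v+\tau))$ does not depend on $\tau$, and for some $\epsilon>0$ $$\sup_w\int\!\!\int\sup_{\lambda_1,\lambda_2,\lambda_3\in B(0,\epsilon)}|{\rm cum}(X(\lambda_1+u),X(\lambda_2+v),X(\lambda_3+w),X(0))|\,dv\,du<\infty.$$ (K) $K:\mathbb R^d\to[0,\infty)$ is continuous, $S_K=\{K>0\}$ is bounded and contains $0$, $\sup K=K(0)=1$, and $K$ is differentiable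 with bounded gradient in a neighbourhood of $0$. (S) The data are observed on the grids $\mathbb T_n=\prod_{\ell=1}^d\{\delta_n,2\delta_n,\dots,n_\ell\delta_n\}$, where $\delta_n>0$ and $n_\ell=n_\ell(n)$. The sampling region $T_n$ is (for all $n$) the closed convex hull of $\mathbb T_n$, or (for all $n$) the box $\prod_\ell[0,n_\ell\delta_n]$. One has $\delta_n\to0$, $|T_n|\to\infty$ (Lebesgue measure), and $|T_n|^{-1/d}T_n$ converges in the Hausdorff metric to a bounded convex set with non-empty interior. For a bandwidth $\Delta_n>0$ the estimator is $$\hat f_n(\theta)=\frac{\delta_n^{2d}}{(2\pi)^d}\sum_{t\in\mathbb T_n}\sum_{s\in\mathbb T_n}e^{\mathrm i(t-s)^\top\theta}\,\frac{X(t)\otimes X(s)}{|T_n\cap(T_n-(t-s))|}\,K\Big(\frac{t-s}{\Delta_n}\Big).$$ \textbf{Theorem.} Assume (C), (V), (K), (S). Let $\beta,L>0$ and suppose that $f$ belongs to the class $\mathcal P_C(\beta,L)$ of all functions $\theta\mapsto(2\pi)^{-d}\int e^{\mathrm i x^\top\theta}C'(x)\,dx$ with $\int(1+\|x\|^\beta)\|C'(x)\|_{\rm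 tr}\,dx\le L$. Suppose that, for some integer $\lambda>0\vee(\beta-1)$, the partial derivatives of $K$ of all orders up to $\lambda+1$ exist on $\mathbb R^d$, those of orders $1,\dots,\lambda$ vanish at $0$, and those of order $\lambda+1$ are bounded. Let $\Theta\subset\mathbb R^d$ be bounded. (i) If $\Delta_n\to\infty$, $\Delta_n^d/|T_n|\to0$ and $\Delta_n\cdot S_K\subset T_n-T_n$ for all sufficiently large $n$, then $$\sup_{\theta\in\Theta}\|\mathbb E\hat f_n(\theta)-f(\theta)\|_{\rm HS}=\mathcal O\big(\delta_n^\gamma+\Delta_n^{-\beta}\big),\qquad n\to\infty.$$ (ii) If $\Delta_n=|T_n|^{1/(2\beta+d)}$, then $$\sup_{\theta\in\Theta}\big(\mathbb E\|\hat f_n(\theta)-f(\theta)\|_{\rm HS}^2\big)^{1/2}=\mathcal O\big(\delta_n^\gamma\vee|T_n|^{-\beta/(2\beta+d)}\big),\qquad n\to\infty.$$ The constants in $\mathcal O(\cdot)$ may depend on the process $X$; no uniformity over $\mathcal P_C(\beta,L)$ is claimed. -/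

import Mathlib

open MeasureTheory Filter Topology
open scoped ENNReal InnerProductSpace Pointwise InnerProduct

noncomputable section

/-- The parameter space `ℝᵈ` with its Euclidean norm. -/
abbrev Pt (d : ℕ) := EuclideanSpace ℝ (Fin d)

section Operators

variable {H : Type*} [NormedAddCommGroup H] [InnerProductSpace ℂ H] [CompleteSpace H]
  {ι : Type*}

/-- Complex conjugation on `H` with respect to the designated real orthonormal basis `e`:
`∑ ⟨x, e_j⟩ e_j ↦ ∑ conj ⟨x, e_j⟩ e_j`. -/
def conjVec (e : HilbertBasis ι ℂ H) (x : H) : H := e.repr.symm (star (e.repr x))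

/-- The trace norm `∑_j ⟨(A* A)^{1/2} e_j, e_j⟩ ∈ [0, ∞]`. -/
def traceNorm (e : HilbertBasis ι ℂ H) (A : H →L[ℂ] H) : ℝ≥0∞ :=
  ∑' j, ENNReal.ofReal (RCLike.re ⟪CFC.sqrt (star A * A) (e j), e j⟫_ℂ)

/-- The Hilbert-Schmidt norm `‖A* A‖_tr^{1/2} ∈ [0, ∞]`. -/
def hsNorm (e : HilbertBasis ι ℂ H) (A : H →L[ℂ] H) : ℝ≥0∞ :=
  traceNorm e (star A * A) ^ (1 / 2 : ℝ)

/-- The Hilbert-Schmidt inner product `trace (A* B)`. -/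
def hsInner (e : HilbertBasis ι ℂ H) (A B : H →L[ℂ] H) : ℂ :=
  ∑' j, ⟪e j, (star A * B) (e j)⟫_ℂ

end Operators

section Processes

variable {H : Type*} [NormedAddCommGroup H] [InnerProductSpace ℂ H] [CompleteSpace H]
  {ι Ω : Type*} [MeasurableSpace Ω] {d : ℕ}

/-- `𝔼[Y ⊗ Z]`, where `(x ⊗ y) z = ⟨z, y⟩ x`. -/
def crossCov (P : Measure Ω) (Y Z : Ω → H) : H →L[ℂ] H :=
  ∫ ω, InnerProductSpace.rankOne ℂ (Y ω) (Z ω) ∂P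

/-- The fourth-order cumulant of `H`-valued random elements with mean zero. -/
def cum4 (e : HilbertBasis ι ℂ H) (P : Measure Ω) (Y₁ Y₂ Y₃ Y₄ : Ω → H) : ℂ :=
  (∫ ω, hsInner e (InnerProductSpace.rankOne ℂ (Y₁ ω) (Y₂ ω))
      (InnerProductSpace.rankOne ℂ (Y₃ ω) (Y₄ ω)) ∂P)
    - hsInner e (crossCov P Y₁ Y₂) (crossCov P Y₃ Y₄)
    - (∫ ω, ⟪Y₁ ω, Y₃ ω⟫_ℂ ∂P) * (∫ ω, ⟪Y₄ ω, Y₂ ω⟫_ℂ ∂P)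
    - hsInner e (crossCov P Y₁ (fun ω => conjVec e (Y₄ ω)))
        (crossCov P Y₃ (fun ω => conjVec e (Y₂ ω)))

/-- `X` is a zero-mean, second-order, covariance stationary process on `ℝᵈ`, real with respect
to the orthonormal basis `e`. -/
structure IsStationaryRealProcess (e : HilbertBasis ι ℂ H) (P : Measure Ω)
    (X : Pt d → Ω → H) : Prop where
  memLp_two : ∀ t, MemLp (X t) 2 P
  mean_zero : ∀ t, ∫ ω, X t ω ∂P = 0
  real : ∀ t, ∀ᵐ ω ∂P, conjVec e (X t ω) = X t ω
  cov_shift : ∀ t s τ, crossCov P (X (t + τ)) (X (s + τ)) = crossCov P (X t) (X s)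
  pseudoCov_shift : ∀ t s τ,
    crossCov P (X (t + τ)) (fun ω => conjVec e (X (s + τ) ω))
      = crossCov P (X t) (fun ω => conjVec e (X s ω))

/-- The stationary covariance operator `C(h) = 𝔼[X(h) ⊗ X(0)]`. -/
def covOp (P : Measure Ω) (X : Pt d → Ω → H) (h : Pt d) : H →L[ℂ] H :=
  crossCov P (X h) (X 0)

/-- `(2π)^{-d} ∫ e^{i xᵀθ} C(x) dx`, a Bochner integral. -/
def fourierOp (C : Pt d → H →L[ℂ] H) (θ : Pt d) : H →L[ℂ] H :=
  ((((2 * Real.pi) ^ d)⁻¹ : ℝ) : ℂ) •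
    ∫ x : Pt d, Complex.exp (Complex.I * ((⟪x, θ⟫_ℝ : ℝ) : ℂ)) • C x

/-- The spectral density of `X`. -/
def spectralDensity (P : Measure Ω) (X : Pt d → Ω → H) : Pt d → H →L[ℂ] H :=
  fourierOp (covOp P X)

/-- The continuous-parameter power law class `P_C(β, L)`: all
`f(θ) = (2π)^{-d} ∫ e^{i xᵀθ} C(x) dx` with `∫ (1 + ‖x‖^β) ‖C(x)‖_tr dx ≤ L`. -/
def powerLawClass (e : HilbertBasis ι ℂ H) (d : ℕ) (β L : ℝ) : Set (Pt d → H →L[ℂ] H) :=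
  {f | ∃ C : Pt d → H →L[ℂ] H, AEStronglyMeasurable C volume ∧
    ∫⁻ x, ENNReal.ofReal (1 + ‖x‖ ^ β) * traceNorm e (C x) ≤ ENNReal.ofReal L ∧
    ∀ θ, f θ = fourierOp C θ}

/-- The covariance function is integrable in trace norm and `L¹`-`γ`-Hölder. -/
structure CovAssumption (e : HilbertBasis ι ℂ H) (γ : ℝ) (C : Pt d → H →L[ℂ] H) : Prop where
  gamma_pos : 0 < γ
  gamma_le_one : γ ≤ 1
  measurable : AEStronglyMeasurable C volume
  integrable : ∫⁻ h, traceNorm e (C h) < ∞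
  holder : ∃ M : ℝ, ∀ δ : ℝ, 0 < δ → δ < 1 →
    ∫⁻ x, (⨆ y ∈ Metric.closedBall x δ, traceNorm e (C y - C x)) ≤ ENNReal.ofReal (M * δ ^ γ)

/-- Fourth moments, fourth-order cumulant stationarity and cumulant integrability. -/
structure CumulantAssumption (e : HilbertBasis ι ℂ H) (P : Measure Ω)
    (X : Pt d → Ω → H) : Prop where
  memLp_four : ∀ t, MemLp (X t) 4 P
  cum_shift : ∀ t s w v τ,
    cum4 e P (X (t + τ)) (X (s + τ)) (X (w + τ)) (X (v + τ)) = cum4 e P (X t) (X s) (X w) (X v)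
  cum_integrable : ∃ δ : ℝ, 0 < δ ∧
    (⨆ w : Pt d, ∫⁻ u : Pt d, ∫⁻ v : Pt d,
      ⨆ l₁ ∈ Metric.ball (0 : Pt d) δ, ⨆ l₂ ∈ Metric.ball (0 : Pt d) δ,
        ⨆ l₃ ∈ Metric.ball (0 : Pt d) δ,
          ‖cum4 e P (X (l₁ + u)) (X (l₂ + v)) (X (l₃ + w)) (X 0)‖ₑ) < ∞

end Processes

section Kernels

variable {d : ℕ}

/-- `S_K = {t : K(t) > 0}`. -/
def kernelSupport (K : Pt d → ℝ) : Set (Pt d) := {t | 0 < K t}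

/-- The standard conditions on the kernel. -/
structure KernelAssumption (K : Pt d → ℝ) : Prop where
  continuous : Continuous K
  nonneg : ∀ t, 0 ≤ K t
  bounded_support : Bornology.IsBounded (kernelSupport K)
  zero_mem_support : (0 : Pt d) ∈ kernelSupport K
  at_zero : K 0 = 1
  le_one : ∀ t, K t ≤ 1
  grad : ∃ ε : ℝ, 0 < ε ∧ (∀ u ∈ Metric.ball (0 : Pt d) ε, DifferentiableAt ℝ K u) ∧
    ∃ M : ℝ, ∀ u ∈ Metric.ball (0 : Pt d) ε, ‖gradient K u‖ ≤ M

/-- Iterated partial derivatives of `K`: `iterPartial K [i₁, …, i_m] = ∂_{i₁} ⋯ ∂_{i_m} K`. -/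
def iterPartial (K : Pt d → ℝ) : List (Fin d) → Pt d → ℝ
  | [] => K
  | i :: l => fun x => lineDeriv ℝ (iterPartial K l) x (EuclideanSpace.single i 1)

/-- All partial derivatives of `K` of order at most `lam + 1` exist everywhere, those of orders
`1, …, lam` vanish at the origin, and those of order `lam + 1` are bounded. -/
structure KernelFlat (K : Pt d → ℝ) (lam : ℕ) : Prop where
  exists_partial : ∀ l : List (Fin d), l.length ≤ lam → ∀ (i : Fin d) (x : Pt d),
    LineDifferentiableAt ℝ (iterPartial K l) x (EuclideanSpace.single i 1)
  vanish : ∀ l : List (Fin d), 1 ≤ l.length → l.length ≤ lam → iterPartial K l 0 = 0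
  bounded : ∀ l : List (Fin d), l.length = lam + 1 → ∃ M : ℝ, ∀ x, |iterPartial K l x| ≤ M

end Kernels

section Sampling

variable {d : ℕ}

open Classical in
/-- The grid `{δ, …, N₁ δ} × ⋯ × {δ, …, N_d δ}`. -/
def gridPoints (δ : ℝ) (N : Fin d → ℕ) : Finset (Pt d) :=
  (Fintype.piFinset fun l => Finset.Icc 1 (N l)).image
    fun k => WithLp.toLp 2 fun l => (k l : ℝ) * δ

/-- The closed convex hull of the grid. -/
def gridHull (δ : ℝ) (N : Fin d → ℕ) : Set (Pt d) :=
  closedConvexHull ℝ (gridPoints δ N : Set (Pt d))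

/-- The box `[0, N₁ δ] × ⋯ × [0, N_d δ]`, the union of the grid cells. -/
def gridBox (δ : ℝ) (N : Fin d → ℕ) : Set (Pt d) :=
  {x | ∀ l, 0 ≤ x l ∧ x l ≤ (N l : ℝ) * δ}

/-- Mixed-domain asymptotics for the grid size `δ n` and sampling region `T n`. -/
structure SamplingAssumption (δ : ℕ → ℝ) (T : ℕ → Set (Pt d)) : Prop where
  delta_pos : ∀ n, 0 < δ n
  delta_tendsto : Tendsto δ atTop (𝓝 0)
  volume_tendsto : Tendsto (fun n => volume.real (T n)) atTop atTop
  shape : ∃ T₀ : Set (Pt d), Bornology.IsBounded T₀ ∧ Convex ℝ T₀ ∧ (interior T₀).Nonempty ∧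
    Tendsto (fun n => Metric.hausdorffEDist
      ((volume.real (T n) ^ (-(1 / (d : ℝ)))) • T n) T₀) atTop (𝓝 0)

end Sampling

section Estimator

variable {H : Type*} [NormedAddCommGroup H] [InnerProductSpace ℂ H] [CompleteSpace H]
  {Ω : Type*} {d : ℕ}

/-- The spectral density estimator for gridded data with grid size `δ`, grid dimensions `N`,
sampling region `T` and bandwidth `Δ`. -/
def specEstimator (K : Pt d → ℝ) (X : Pt d → Ω → H) (δ : ℝ) (N : Fin d → ℕ) (T : Set (Pt d))
    (Δ : ℝ) (θ : Pt d) (ω : Ω) : H →L[ℂ] H :=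
  ((δ ^ (2 * d) / (2 * Real.pi) ^ d : ℝ) : ℂ) •
    ∑ t ∈ gridPoints δ N, ∑ s ∈ gridPoints δ N,
      (Complex.exp (Complex.I * ((⟪t - s, θ⟫_ℝ : ℝ) : ℂ)) *
        ((K (Δ⁻¹ • (t - s)) / volume.real (T ∩ (fun x => x - (t - s)) '' T) : ℝ) : ℂ)) •
          InnerProductSpace.rankOne ℂ (X t ω) (X s ω)

end Estimator

end

/-! ### Trace norm, Hilbert-Schmidt norm and absolute diagonal sum. -/

section HilbertSchmidt

variable {H : Type*} [NormedAddCommGroup H] [InnerProductSpace ℂ H]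
  {ι : Type*}

/-! The mean squared error is at most twice the variance plus twice the squared bias, all in
Hilbert-Schmidt norm. Each part is bounded explicitly on a fixed grid satisfying `FineMesh`, with
constants depending only on the process, the kernel and `Θ`; the limit in `n` enters only to show
that `FineMesh` eventually holds.

Bias. Grouping pairs of grid points by lag turns the expectation into `(2π)^{-d}` times the integral
of a function constant on cells of side `δ` (`integral_specEstimator_eq_integral`). Comparison with
the integral of `e^{i xᵀθ} C(x)` leaves these errors: moving `C` to the cell corner costs `O(δ^γ)`
by the `L¹`-Hölder condition; the edge ratio, the character and the kernel cost `O(δ)` each,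
absorbed since `γ ≤ 1`; and `K(x/Δ) - 1` is `O(Δ^{-β} ‖x‖^β)` by a Taylor argument that uses partial
derivatives only. The last error needs a finite `β`-moment of `C`. Membership in the power law class
gives it for some representative `C'`, and Fourier uniqueness identifies `C'` with `C` almost
everywhere (`lintegral_rpow_mul_hsNorm_le`).

Variance. The second moment of the centred estimator is a double sum of covariances of dyads
(`lintegral_hsNorm_sq_sum_centered_le`). As the process is real, each covariance is a fourth-order
cumulant plus two terms bounded by products of covariance sizes at lags. Summing these over two free
lattice variables gives at most integrals that are finite by assumption. What remains is one sum
over the grid, of order `|T| δ^{-d}`, and one over lags of length at most `RΔ`, of order `(Δ/δ)^d`;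
the weights of order `δ^{2d}/|T|` make the total `O(Δ^d/|T|)`.

Geometry. Hausdorff convergence of the rescaled regions bounds every side of the box below by a
multiple of `|T|^{1/d}` (`rpow_volume_le_side`). Hence `Δ^d/|T| → 0` makes all sides large compared
with `Δ`, and relevant overlaps have volume at least `|T|/2^d`. For `Δ = |T|^{1/(2β+d)}` the
variance `Δ^d/|T|` equals `Δ^{-2β}`, the square of the bias rate. -/

theorem ENNReal.two_mul_mul_le_sq_add_sq (a b : ℝ≥0∞) : 2 * (a * b) ≤ a ^ 2 + b ^ 2 := by
  induction a with
  | top => simp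
  | coe a =>
    induction b with
    | top => simp
    | coe b =>
      have := two_mul_le_add_sq (a : ℝ) b
      norm_cast
      rw [← NNReal.coe_le_coe]
      push_cast
      linarith

theorem ENNReal.rpow_half_sq (a : ℝ≥0∞) : (a ^ (1 / 2 : ℝ)) ^ 2 = a := by
  rw [← ENNReal.rpow_natCast, ← ENNReal.rpow_mul]
  norm_num

theorem ENNReal.sq_rpow_half (a : ℝ≥0∞) : (a ^ 2) ^ (1 / 2 : ℝ) = a := by
  rw [← ENNReal.rpow_natCast, ← ENNReal.rpow_mul]
  norm_num

theorem ENNReal.sq_injective : Function.Injective fun a : ℝ≥0∞ => a ^ 2 :=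
  fun a b (h : a ^ 2 = b ^ 2) => by rw [← ENNReal.sq_rpow_half a, ← ENNReal.sq_rpow_half b, h]

/-- Parseval's identity in `[0, ∞]`. -/
theorem tsum_enorm_inner_sq (e : HilbertBasis ι ℂ H) (x : H) :
    ∑' j, ‖⟪e j, x⟫_ℂ‖ₑ ^ 2 = ‖x‖ₑ ^ 2 := by
  have h2 : HasSum (fun j => ‖⟪e j, x⟫_ℂ‖ ^ 2) (‖x‖ ^ 2) := by
    have h := e.hasSum_inner_mul_inner x x
    have h3 : HasSum (fun j => ((‖⟪e j, x⟫_ℂ‖ ^ 2 : ℝ) : ℂ)) ((‖x‖ ^ 2 : ℝ) : ℂ) := by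
      have h4 : ∀ j, ((‖⟪e j, x⟫_ℂ‖ ^ 2 : ℝ) : ℂ) = ⟪x, e j⟫_ℂ * ⟪e j, x⟫_ℂ := fun j => by
        rw [← inner_conj_symm x (e j), RCLike.conj_mul]
        norm_cast
      have h5 : ((‖x‖ ^ 2 : ℝ) : ℂ) = ⟪x, x⟫_ℂ := by
        rw [inner_self_eq_norm_sq_to_K]
        norm_cast
      simp_rw [h4, h5]
      exact h
    exact_mod_cast h3
  have h4 : ∀ y : ℝ, 0 ≤ y → ENNReal.ofReal (y ^ 2) = ENNReal.ofReal y ^ 2 := fun y hy =>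
    ENNReal.ofReal_pow hy 2
  simp_rw [← ofReal_norm, ← h4 _ (norm_nonneg _)]
  rw [← ENNReal.ofReal_tsum_of_nonneg (fun _ => by positivity) h2.summable, h2.tsum_eq]

/-- The squared Hilbert-Schmidt norm `∑ ‖A e_j‖²`. -/
noncomputable def hsSq (e : HilbertBasis ι ℂ H) (A : H →L[ℂ] H) : ℝ≥0∞ :=
  ∑' j, ‖A (e j)‖ₑ ^ 2

/-- The absolute sum `∑ |⟨e_j, A e_j⟩|` of the diagonal. -/
noncomputable def diagNorm (e : HilbertBasis ι ℂ H) (A : H →L[ℂ] H) : ℝ≥0∞ :=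
  ∑' j, ‖⟪e j, A (e j)⟫_ℂ‖ₑ

theorem diagNorm_add_le (e : HilbertBasis ι ℂ H) (A B : H →L[ℂ] H) :
    diagNorm e (A + B) ≤ diagNorm e A + diagNorm e B := by
  rw [diagNorm, diagNorm, diagNorm, ← ENNReal.tsum_add]
  gcongr with j
  simp only [add_apply, inner_add_right]
  exact enorm_add_le _ _

theorem enorm_inner_le_mul (x y : H) : ‖⟪x, y⟫_ℂ‖ₑ ≤ ‖x‖ₑ * ‖y‖ₑ := by
  simp only [← ofReal_norm, ← ENNReal.ofReal_mul (norm_nonneg x)]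
  exact ENNReal.ofReal_le_ofReal (norm_inner_le_norm x y)

theorem hsSq_mul_le (e : HilbertBasis ι ℂ H) (V A : H →L[ℂ] H) :
    hsSq e (V * A) ≤ ‖V‖ₑ ^ 2 * hsSq e A := by
  rw [hsSq, hsSq, ← ENNReal.tsum_mul_left]
  gcongr with j
  rw [← mul_pow]
  gcongr
  exact V.le_opENorm _

variable [CompleteSpace H]

/-- By Parseval both sides are the sum of all squared matrix entries, taken in the two orders. -/
theorem hsSq_star (e : HilbertBasis ι ℂ H) (A : H →L[ℂ] H) : hsSq e (star A) = hsSq e A := by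
  simp_rw [hsSq, ← tsum_enorm_inner_sq e]
  rw [ENNReal.tsum_comm]
  refine tsum_congr fun j => tsum_congr fun k => ?_
  rw [ContinuousLinearMap.star_eq_adjoint, ContinuousLinearMap.adjoint_inner_right,
    ← inner_conj_symm, RCLike.enorm_conj]

/-- The coordinates of `star B x` are `⟨B e_j, x⟩`, so Cauchy-Schwarz in each coordinate bounds the
norm of the adjoint; `hsSq_star` transfers this to the operator itself. -/
theorem enorm_sq_le_hsSq (e : HilbertBasis ι ℂ H) (A : H →L[ℂ] H) : ‖A‖ₑ ^ 2 ≤ hsSq e A := by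
  have h1 : ∀ B : H →L[ℂ] H, ‖star B‖ₑ ≤ hsSq e B ^ (1 / 2 : ℝ) := by
    intro B
    refine ContinuousLinearMap.opENorm_le_bound _ fun x => ?_
    have h2 : ‖(star B) x‖ₑ ^ 2 ≤ hsSq e B * ‖x‖ₑ ^ 2 := by
      rw [← tsum_enorm_inner_sq e, hsSq, ← ENNReal.tsum_mul_right]
      gcongr with j
      rw [ContinuousLinearMap.star_eq_adjoint, ContinuousLinearMap.adjoint_inner_right, ← mul_pow]
      gcongr
      exact enorm_inner_le_mul _ _
    have h3 := ENNReal.rpow_le_rpow h2 (z := 1 / 2) (by norm_num)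
    rwa [ENNReal.mul_rpow_of_nonneg _ _ (by norm_num), ENNReal.sq_rpow_half,
      ENNReal.sq_rpow_half] at h3
  have h2 := h1 (star A)
  rw [star_star, hsSq_star] at h2
  calc ‖A‖ₑ ^ 2 ≤ (hsSq e A ^ (1 / 2 : ℝ)) ^ 2 := by gcongr
    _ = hsSq e A := ENNReal.rpow_half_sq _

theorem ofReal_re_inner_mul_self (A : H →L[ℂ] H) (x : H) :
    ENNReal.ofReal (RCLike.re ⟪(star A * A) x, x⟫_ℂ) = ‖A x‖ₑ ^ 2 := by
  rw [mul_apply_eq_comp, ContinuousLinearMap.star_eq_adjoint,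
    ContinuousLinearMap.adjoint_inner_left, inner_self_eq_norm_sq,
    ENNReal.ofReal_pow (norm_nonneg _), ofReal_norm]

/-- Since `A* A` is positive it is its own absolute value, and the diagonal of `A* A` consists of
the `‖A e_j‖²`. Everything later works with these sums instead of the functional calculus. -/
theorem hsNorm_eq (e : HilbertBasis ι ℂ H) (A : H →L[ℂ] H) :
    hsNorm e A = hsSq e A ^ (1 / 2 : ℝ) := by
  have h : CFC.sqrt (star (star A * A) * (star A * A)) = star A * A := by
    have : star (star A * A) = star A * A := by simp
    rw [this]
    exact CFC.sqrt_mul_self _ (star_mul_self_nonneg A)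
  rw [hsNorm, traceNorm, h, hsSq]
  simp_rw [ofReal_re_inner_mul_self]

theorem hsNorm_sq (e : HilbertBasis ι ℂ H) (A : H →L[ℂ] H) : hsNorm e A ^ 2 = hsSq e A := by
  rw [hsNorm_eq, ENNReal.rpow_half_sq]

theorem enorm_le_hsNorm (e : HilbertBasis ι ℂ H) (A : H →L[ℂ] H) : ‖A‖ₑ ≤ hsNorm e A := by
  rw [← ENNReal.pow_le_pow_left_iff two_ne_zero, hsNorm_sq]
  exact enorm_sq_le_hsSq e A

/-- With `B = |A|` and `Q = |A|^{1/2}`, the trace norm of `A` is the squared Hilbert-Schmidt norm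
of `Q`. -/
theorem exists_sqrt_abs (e : HilbertBasis ι ℂ H) (A : H →L[ℂ] H) :
    ∃ B Q : H →L[ℂ] H, 0 ≤ B ∧ star Q = Q ∧ Q * Q = B ∧ (∀ x, ‖B x‖ = ‖A x‖) ∧
      traceNorm e A = hsSq e Q := by
  set B := CFC.sqrt (star A * A) with hB
  have hB0 : 0 ≤ B := CFC.sqrt_nonneg _
  have hBB : B * B = star A * A := CFC.sqrt_mul_sqrt_self _ (star_mul_self_nonneg A)
  have hQQ : CFC.sqrt B * CFC.sqrt B = B := CFC.sqrt_mul_sqrt_self _ hB0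
  have hQs : star (CFC.sqrt B) = CFC.sqrt B := (CFC.sqrt_nonneg B).isSelfAdjoint
  have hBs : star B = B := hB0.isSelfAdjoint
  refine ⟨B, CFC.sqrt B, hB0, hQs, hQQ, fun x => ?_, ?_⟩
  · have h1 := ofReal_re_inner_mul_self B x
    have h2 := ofReal_re_inner_mul_self A x
    rw [hBs, hBB, h2] at h1
    have h3 : ‖A x‖ₑ = ‖B x‖ₑ := ENNReal.sq_injective h1
    rw [← toReal_enorm, ← toReal_enorm, h3]
  · rw [traceNorm, hsSq, ← hB]
    refine tsum_congr fun j => ?_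
    rw [← ofReal_re_inner_mul_self, hQs, hQQ]

/-- With `Q = |A|^{1/2}`, the ideal property gives `‖Q²‖_HS ≤ ‖Q‖ ‖Q‖_HS ≤ ‖Q‖_HS²`, and the right
side is the trace norm. -/
theorem hsNorm_le_traceNorm (e : HilbertBasis ι ℂ H) (A : H →L[ℂ] H) :
    hsNorm e A ≤ traceNorm e A := by
  obtain ⟨B, Q, -, -, hQB, hBA, htr⟩ := exists_sqrt_abs e A
  rw [← ENNReal.pow_le_pow_left_iff two_ne_zero, hsNorm_sq, htr]
  calc hsSq e A = hsSq e (Q * Q) := by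
        rw [hQB, hsSq, hsSq]
        refine tsum_congr fun j => ?_
        rw [← ofReal_norm, ← ofReal_norm, hBA]
    _ ≤ ‖Q‖ₑ ^ 2 * hsSq e Q := hsSq_mul_le e Q Q
    _ ≤ hsSq e Q * hsSq e Q := by gcongr; exact enorm_sq_le_hsSq e Q
    _ = hsSq e Q ^ 2 := (sq _).symm

/-- An approximate polar decomposition. -/
theorem exists_contraction_approx_polar {A B : H →L[ℂ] H} (hB : 0 ≤ B) (hBA : ∀ x, ‖B x‖ = ‖A x‖)
    {ε : ℝ} (hε : 0 < ε) : ∃ V : H →L[ℂ] H, ‖V‖ ≤ 1 ∧ A = V * B + (ε : ℂ) • V := by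
  have hBp : B.IsPositive := (ContinuousLinearMap.nonneg_iff_isPositive B).1 hB
  have hu : IsUnit (B + (ε : ℂ) • (1 : H →L[ℂ] H)) := by
    refine CStarAlgebra.isUnit_of_le ((ε : ℂ) • (1 : H →L[ℂ] H)) (by simpa using hB) ?_
    refine IsUnit.isStrictlyPositive ?_ ?_
    · exact isUnit_one.smul (Units.mk0 (ε : ℂ) (by exact_mod_cast hε.ne'))
    · rw [ContinuousLinearMap.nonneg_iff_isPositive]
      exact ContinuousLinearMap.isPositive_one.smul_of_nonneg (by exact_mod_cast hε.le)
  obtain ⟨W, hW1, hW2⟩ := isUnit_iff_exists.1 hu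
  have hle : ∀ y, ‖B y‖ ≤ ‖(B + (ε : ℂ) • (1 : H →L[ℂ] H)) y‖ := by
    intro y
    refine le_of_sq_le_sq ?_ (norm_nonneg _)
    have : (B + (ε : ℂ) • (1 : H →L[ℂ] H)) y = B y + (ε : ℂ) • y := by simp
    rw [this, @norm_add_sq ℂ, inner_smul_right]
    have h1 := hBp.re_inner_nonneg_left y
    have h2 : RCLike.re ((ε : ℂ) * ⟪B y, y⟫_ℂ) = ε * RCLike.re ⟪B y, y⟫_ℂ := by
      simp
    rw [h2]
    have := mul_nonneg hε.le h1
    nlinarith [sq_nonneg ‖(ε : ℂ) • y‖]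
  -- `V = A (B + ε)⁻¹` is a contraction because `‖A y‖ = ‖B y‖ ≤ ‖(B + ε) y‖`, the inequality by
  -- positivity of `B`.
  refine ⟨A * W, ?_, ?_⟩
  · refine ContinuousLinearMap.opNorm_le_bound _ zero_le_one fun x => ?_
    have h1 := hle (W x)
    have h2 : (B + (ε : ℂ) • (1 : H →L[ℂ] H)) (W x) = x := by
      rw [← mul_apply_eq_comp, hW1]; rfl
    rw [h2, hBA] at h1
    simpa using h1
  · calc A = A * (W * (B + (ε : ℂ) • (1 : H →L[ℂ] H))) := by rw [hW2, mul_one]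
      _ = _ := by rw [mul_add, mul_add, mul_smul_comm, mul_one, mul_smul_comm, mul_assoc]

/-- Up to an error `ε` per diagonal entry, `A = V Q Q` with `V` a contraction, so the entry is `⟨Q
V* e_j, Q e_j⟩`. The arithmetic-geometric mean inequality bounds the sum by the squared
Hilbert-Schmidt norms of `Q V*` and `Q`. Restricting to finitely many indices lets `ε` tend to `0`.
-/
theorem diagNorm_le_traceNorm (e : HilbertBasis ι ℂ H) (A : H →L[ℂ] H) :
    diagNorm e A ≤ traceNorm e A := by
  obtain ⟨B, Q, hB0, hQs, hQB, hBA, htr⟩ := exists_sqrt_abs e A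
  rw [diagNorm, ENNReal.tsum_eq_iSup_sum]
  refine iSup_le fun J => ?_
  have key : ∀ ε : ℝ, 0 < ε →
      ∑ j ∈ J, ‖⟪e j, A (e j)⟫_ℂ‖ₑ ≤ traceNorm e A + J.card * ENNReal.ofReal ε := by
    intro ε hε
    obtain ⟨V, hV, hAV⟩ := exists_contraction_approx_polar hB0 hBA hε
    have hV' : ‖V‖ₑ ≤ 1 := by rw [← ofReal_norm]; exact ENNReal.ofReal_le_one.2 hV
    have h1 : ∀ j, ‖⟪e j, A (e j)⟫_ℂ‖ₑ
        ≤ ‖(Q * star V) (e j)‖ₑ * ‖Q (e j)‖ₑ + ENNReal.ofReal ε := by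
      intro j
      have h2 : ⟪e j, A (e j)⟫_ℂ
          = ⟪(Q * star V) (e j), Q (e j)⟫_ℂ + ⟪e j, (ε : ℂ) • V (e j)⟫_ℂ := by
        conv_lhs => rw [hAV]
        rw [add_apply, inner_add_right]
        congr 1
        have h3 : Q * star V = ContinuousLinearMap.adjoint (V * Q) := by
          rw [← ContinuousLinearMap.star_eq_adjoint, star_mul, hQs]
        rw [h3, ContinuousLinearMap.adjoint_inner_left, ← mul_apply_eq_comp,
          mul_assoc, hQB]
      rw [h2]
      refine (enorm_add_le _ _).trans (add_le_add (enorm_inner_le_mul _ _) ?_)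
      refine (enorm_inner_le_mul _ _).trans ?_
      have h3 : ‖e j‖ₑ = 1 := by
        rw [← ofReal_norm, e.orthonormal.1 j]; simp
      rw [h3, one_mul, enorm_smul]
      calc _ ≤ ‖(ε : ℂ)‖ₑ * (‖V‖ₑ * ‖e j‖ₑ) := by gcongr; exact V.le_opENorm _
        _ ≤ ‖(ε : ℂ)‖ₑ * (1 * 1) := by gcongr; exact h3.le
        _ = _ := by rw [← ofReal_norm]; simp [abs_of_pos hε]
    have h4 : ∑' j, ‖(Q * star V) (e j)‖ₑ * ‖Q (e j)‖ₑ ≤ traceNorm e A := by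
      have h5 : hsSq e (Q * star V) ≤ traceNorm e A := by
        rw [← hsSq_star, star_mul, star_star, hQs, htr]
        refine (hsSq_mul_le e V Q).trans ?_
        calc _ ≤ 1 ^ 2 * hsSq e Q := by gcongr
          _ = _ := by simp
      have h6 : 2 * ∑' j, ‖(Q * star V) (e j)‖ₑ * ‖Q (e j)‖ₑ ≤ 2 * traceNorm e A := by
        rw [← ENNReal.tsum_mul_left]
        calc _ ≤ ∑' j, (‖(Q * star V) (e j)‖ₑ ^ 2 + ‖Q (e j)‖ₑ ^ 2) := by
              gcongr; exact ENNReal.two_mul_mul_le_sq_add_sq _ _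
          _ = hsSq e (Q * star V) + hsSq e Q := ENNReal.tsum_add
          _ ≤ _ := by rw [two_mul]; exact add_le_add h5 htr.ge
      exact (ENNReal.mul_le_mul_iff_right (by simp) (by simp)).1 h6
    calc _ ≤ ∑ j ∈ J, (‖(Q * star V) (e j)‖ₑ * ‖Q (e j)‖ₑ + ENNReal.ofReal ε) := by
          gcongr; exact h1 _
      _ = ∑ j ∈ J, ‖(Q * star V) (e j)‖ₑ * ‖Q (e j)‖ₑ + J.card * ENNReal.ofReal ε := by
          rw [Finset.sum_add_distrib, Finset.sum_const, nsmul_eq_mul]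
      _ ≤ _ := by gcongr; exact (ENNReal.sum_le_tsum J).trans h4
  have hlim : Tendsto (fun ε : ℝ => traceNorm e A + J.card * ENNReal.ofReal ε) (𝓝[>] 0)
      (𝓝 (traceNorm e A + J.card * ENNReal.ofReal 0)) := by
    refine Tendsto.const_add _ (ENNReal.Tendsto.const_mul ?_ (Or.inr (by simp)))
    exact (ENNReal.continuous_ofReal.tendsto 0).mono_left nhdsWithin_le_nhds
  simp only [ENNReal.ofReal_zero, mul_zero, add_zero] at hlim
  exact ge_of_tendsto hlim (eventually_mem_nhdsWithin.mono fun ε hε => key ε hε)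

/-- Finite sections of the Hilbert-Schmidt norm. -/
theorem hsNorm_eq_iSup (e : HilbertBasis ι ℂ H) (A : H →L[ℂ] H) :
    hsNorm e A = ⨆ J : Finset ι, (∑ j ∈ J, ‖A (e j)‖ₑ ^ 2) ^ (1 / 2 : ℝ) := by
  rw [hsNorm_eq, hsSq, ENNReal.tsum_eq_iSup_sum]
  exact (ENNReal.monotone_rpow_of_nonneg (by norm_num : (0 : ℝ) ≤ 1 / 2)).map_iSup_of_continuousAt
    ENNReal.continuous_rpow_const.continuousAt (by simp)

theorem hsNorm_zero (e : HilbertBasis ι ℂ H) : hsNorm e 0 = 0 := by simp [hsNorm_eq, hsSq]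

theorem hsNorm_smul (e : HilbertBasis ι ℂ H) (c : ℂ) (A : H →L[ℂ] H) :
    hsNorm e (c • A) = ‖c‖ₑ * hsNorm e A := by
  refine ENNReal.sq_injective ?_
  simp only [mul_pow, hsNorm_sq, hsSq, smul_apply, enorm_smul]
  rw [ENNReal.tsum_mul_left]

theorem hsNorm_add_le (e : HilbertBasis ι ℂ H) (A B : H →L[ℂ] H) :
    hsNorm e (A + B) ≤ hsNorm e A + hsNorm e B := by
  rw [hsNorm_eq_iSup e (A + B)]
  refine iSup_le fun J => ?_
  have h1 := ENNReal.Lp_add_le J (fun j => ‖A (e j)‖ₑ) (fun j => ‖B (e j)‖ₑ) one_le_two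
  simp only [ENNReal.rpow_ofNat] at h1
  calc _ ≤ (∑ j ∈ J, (‖A (e j)‖ₑ + ‖B (e j)‖ₑ) ^ 2) ^ (1 / 2 : ℝ) := by
        gcongr; exact enorm_add_le _ _
    _ ≤ _ := h1
    _ ≤ _ := by
        rw [hsNorm_eq_iSup, hsNorm_eq_iSup]
        exact add_le_add (le_iSup (fun J : Finset ι => (∑ j ∈ J, ‖A (e j)‖ₑ ^ 2) ^ (1 / 2 : ℝ)) J)
          (le_iSup (fun J : Finset ι => (∑ j ∈ J, ‖B (e j)‖ₑ ^ 2) ^ (1 / 2 : ℝ)) J)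

/-- Minkowski's integral inequality for the Hilbert-Schmidt norm. -/
theorem hsNorm_integral_le (e : HilbertBasis ι ℂ H) {α : Type*} [MeasurableSpace α]
    {μ : Measure α} (F : α → H →L[ℂ] H) :
    hsNorm e (∫ x, F x ∂μ) ≤ ∫⁻ x, hsNorm e (F x) ∂μ := by
  by_cases hF : Integrable F μ
  swap
  -- The Bochner integral of a non-integrable function is `0` by convention, so no integrability is
  -- required.
  · rw [integral_undef hF, hsNorm_zero]; exact zero_le
  rw [hsNorm_eq_iSup]
  refine iSup_le fun J => ?_
  -- On a finite section the Hilbert-Schmidt norm is the norm of a continuous linear image in a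
  -- finite `ℓ²` product. There the integral commutes with `Φ` and the norm inequality for Bochner
  -- integrals applies.
  let Φ : (H →L[ℂ] H) →L[ℂ] PiLp 2 (fun _ : J => H) :=
    (PiLp.continuousLinearEquiv 2 ℂ (fun _ : J => H)).symm.toContinuousLinearMap.comp
      (ContinuousLinearMap.pi fun j : J => ContinuousLinearMap.apply ℂ H (e j))
  have hΦ : ∀ A : H →L[ℂ] H, ‖Φ A‖ₑ = (∑ j ∈ J, ‖A (e j)‖ₑ ^ 2) ^ (1 / 2 : ℝ) := by
    intro A
    rw [← ofReal_norm, PiLp.norm_eq_of_L2, Real.sqrt_eq_rpow,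
      ← ENNReal.ofReal_rpow_of_nonneg (by positivity) (by norm_num),
      ENNReal.ofReal_sum_of_nonneg (fun _ _ => by positivity), ← Finset.sum_coe_sort J]
    congr 1
    refine Finset.sum_congr rfl fun j _ => ?_
    rw [ENNReal.ofReal_pow (norm_nonneg _), ofReal_norm]
    rfl
  rw [← hΦ, ← ContinuousLinearMap.integral_comp_comm Φ hF]
  refine (enorm_integral_le_lintegral_enorm _).trans (lintegral_mono fun x => ?_)
  rw [hΦ, hsNorm_eq_iSup]
  exact le_iSup (fun J : Finset ι => (∑ j ∈ J, ‖F x (e j)‖ₑ ^ 2) ^ (1 / 2 : ℝ)) J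

omit [CompleteSpace H] in
-- Distinct basis vectors are `√2` apart, so balls of radius `1/2` around them are disjoint.
-- Countability makes the sums over the basis measurable and allows exchanging them with integrals.
theorem countable_of_separable [TopologicalSpace.SeparableSpace H] (e : HilbertBasis ι ℂ H) :
    Countable ι := by
  have h : ∀ i j, i ≠ j → dist (e i) (e j) = √2 := by
    intro i j hij
    rw [dist_eq_norm, ← Real.sqrt_sq (norm_nonneg _), @norm_sub_sq ℂ, e.orthonormal.1 i,
      e.orthonormal.1 j, e.orthonormal.2 hij]
    norm_num
  refine Pairwise.countable_of_isOpen_disjoint (s := fun i => Metric.ball (e i) (1 / 2)) ?_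
    (fun _ => Metric.isOpen_ball) (fun i => ⟨e i, by simp⟩)
  intro i j hij
  refine Metric.ball_disjoint_ball ?_
  rw [h i j hij]
  norm_num

theorem aemeasurable_hsNorm [Countable ι] (e : HilbertBasis ι ℂ H) {α : Type*} [MeasurableSpace α]
    {μ : Measure α} {F : α → H →L[ℂ] H} (hF : AEStronglyMeasurable F μ) :
    AEMeasurable (fun x => hsNorm e (F x)) μ := by
  simp_rw [hsNorm_eq, hsSq]
  refine (AEMeasurable.tsum fun j => ?_).pow_const _
  exact ((ContinuousLinearMap.apply ℂ H (e j)).continuous.comp_aestronglyMeasurable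
    hF).enorm.pow_const _

omit [CompleteSpace H] in
theorem aemeasurable_diagNorm [Countable ι] (e : HilbertBasis ι ℂ H) {α : Type*}
    [MeasurableSpace α] {μ : Measure α} {F : α → H →L[ℂ] H} (hF : AEStronglyMeasurable F μ) :
    AEMeasurable (fun x => diagNorm e (F x)) μ := by
  simp_rw [diagNorm]
  refine AEMeasurable.tsum fun j => ?_
  have h := (ContinuousLinearMap.apply ℂ H (e j)).continuous.comp_aestronglyMeasurable hF
  exact ((continuous_const.inner continuous_id).comp_aestronglyMeasurable h).enorm

end HilbertSchmidt

/-! ### Moments of dyads and second moments of centred sums. -/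

section SecondOrder

variable {H : Type*} [NormedAddCommGroup H] [InnerProductSpace ℂ H]
  {ι Ω : Type*} [MeasurableSpace Ω] {P : Measure Ω}

open InnerProductSpace (rankOne)

theorem continuous_rankOne : Continuous fun p : H × H => rankOne ℂ p.1 p.2 := by
  have h : Continuous fun p : H × H => ContinuousLinearMap.smulRightL ℂ H H (innerSL ℂ p.2) p.1 :=
    (ContinuousLinearMap.smulRightL ℂ H H).continuous₂.comp
      (((innerSL ℂ (E := H)).continuous.comp continuous_snd).prodMk continuous_fst)
  exact h

theorem aestronglyMeasurable_rankOne {Y Z : Ω → H} (hY : AEStronglyMeasurable Y P)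
    (hZ : AEStronglyMeasurable Z P) :
    AEStronglyMeasurable (β := H →L[ℂ] H) (fun ω => rankOne ℂ (Y ω) (Z ω)) P := by
  have h2 : AEStronglyMeasurable (fun ω => (Y ω, Z ω)) P := hY.prodMk hZ
  have h := continuous_rankOne.comp_aestronglyMeasurable h2
  exact h

theorem integrable_rankOne {Y Z : Ω → H} (hY : MemLp Y 2 P) (hZ : MemLp Z 2 P) :
    Integrable (fun ω => rankOne ℂ (Y ω) (Z ω)) P := by
  refine (hY.norm.integrable_mul hZ.norm).mono' (aestronglyMeasurable_rankOne hY.1 hZ.1) ?_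
  filter_upwards with ω
  simp

theorem hasSum_norm_inner_sq (e : HilbertBasis ι ℂ H) (x : H) :
    HasSum (fun j => ‖⟪e j, x⟫_ℂ‖ ^ 2) (‖x‖ ^ 2) := by
  have h := tsum_enorm_inner_sq e x
  have h1 : ∀ y : ℝ, 0 ≤ y → ENNReal.ofReal (y ^ 2) = ENNReal.ofReal y ^ 2 := fun y hy =>
    ENNReal.ofReal_pow hy 2
  simp_rw [← ofReal_norm, ← h1 _ (norm_nonneg _)] at h
  have hs : Summable (fun j => ‖⟪e j, x⟫_ℂ‖ ^ 2) := by
    have h2 := ENNReal.summable_toReal (f := fun j => ENNReal.ofReal (‖⟪e j, x⟫_ℂ‖ ^ 2))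
      (by rw [h]; simp)
    simpa using h2
  rw [← ENNReal.ofReal_tsum_of_nonneg (fun _ => by positivity) hs,
    ENNReal.ofReal_eq_ofReal_iff (tsum_nonneg fun _ => by positivity) (by positivity)] at h
  exact h ▸ hs.hasSum

/-- `𝔼 ∑_j |⟨e_j, Y⟩⟨Z, e_j⟩| < ∞` and the sum may be taken outside. -/
theorem hasSum_integral_inner_mul_inner [Countable ι] (e : HilbertBasis ι ℂ H) {Y Z : Ω → H}
    {φ : Ω → ℂ} (hφ : AEStronglyMeasurable φ P)
    (hY : AEStronglyMeasurable Y P) (hZ : AEStronglyMeasurable Z P)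
    (hint : Integrable (fun ω => ‖φ ω‖ * (‖Y ω‖ ^ 2 + ‖Z ω‖ ^ 2)) P) :
    HasSum (fun j => ∫ ω, φ ω * (⟪Z ω, e j⟫_ℂ * ⟪e j, Y ω⟫_ℂ) ∂P)
      (∫ ω, φ ω * ⟪Z ω, Y ω⟫_ℂ ∂P) := by
  have hb : ∀ ω, HasSum (fun j => ‖φ ω‖ * (‖⟪e j, Y ω⟫_ℂ‖ ^ 2 + ‖⟪e j, Z ω⟫_ℂ‖ ^ 2))
      (‖φ ω‖ * (‖Y ω‖ ^ 2 + ‖Z ω‖ ^ 2)) := fun ω =>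
    ((hasSum_norm_inner_sq e (Y ω)).add (hasSum_norm_inner_sq e (Z ω))).mul_left _
  refine hasSum_integral_of_dominated_convergence
    (fun j ω => ‖φ ω‖ * (‖⟪e j, Y ω⟫_ℂ‖ ^ 2 + ‖⟪e j, Z ω⟫_ℂ‖ ^ 2)) ?_ ?_ ?_ ?_ ?_
  · exact fun j => hφ.mul ((hZ.inner aestronglyMeasurable_const).mul
      (aestronglyMeasurable_const.inner hY))
  · intro j
    filter_upwards with ω
    rw [norm_mul, norm_mul, norm_inner_symm (Z ω)]
    gcongr
    nlinarith [sq_nonneg (‖⟪e j, Y ω⟫_ℂ‖ - ‖⟪e j, Z ω⟫_ℂ‖), sq_nonneg ‖⟪e j, Y ω⟫_ℂ‖,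
      sq_nonneg ‖⟪e j, Z ω⟫_ℂ‖]
  · filter_upwards with ω using (hb ω).summable
  · simpa only [(hb _).tsum_eq] using hint
  · filter_upwards with ω using (e.hasSum_inner_mul_inner (Z ω) (Y ω)).mul_left _

variable [CompleteSpace H]

omit [CompleteSpace H] in
theorem crossCov_apply {Y Z : Ω → H} (hY : MemLp Y 2 P) (hZ : MemLp Z 2 P) (x : H) :
    crossCov P Y Z x = ∫ ω, ⟪Z ω, x⟫_ℂ • Y ω ∂P := by
  rw [crossCov, ContinuousLinearMap.integral_apply (integrable_rankOne hY hZ)]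
  simp

/-- The trace of a cross covariance operator. -/
theorem enorm_integral_inner_le_diagNorm [Countable ι] (e : HilbertBasis ι ℂ H) {Y Z : Ω → H}
    (hY : MemLp Y 2 P) (hZ : MemLp Z 2 P) :
    ‖∫ ω, ⟪Z ω, Y ω⟫_ℂ ∂P‖ₑ ≤ diagNorm e (crossCov P Y Z) := by
  have h0 : Integrable (fun ω => ‖Y ω‖ ^ 2 + ‖Z ω‖ ^ 2) P :=
    hY.norm.integrable_sq.add hZ.norm.integrable_sq
  have h := hasSum_integral_inner_mul_inner e (φ := fun _ => 1) aestronglyMeasurable_const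
    hY.1 hZ.1 (by simpa using h0)
  simp only [one_mul] at h
  have h1 : ∀ j, ∫ ω, ⟪Z ω, e j⟫_ℂ * ⟪e j, Y ω⟫_ℂ ∂P = ⟪e j, crossCov P Y Z (e j)⟫_ℂ := by
    intro j
    have hint : Integrable (fun ω => ⟪Z ω, e j⟫_ℂ • Y ω) P := by
      simpa using (integrable_rankOne hY hZ).apply_continuousLinearMap (e j)
    rw [crossCov_apply hY hZ, ← integral_inner hint]
    simp [inner_smul_right]
  rw [← h.tsum_eq, diagNorm]
  simp_rw [h1]
  exact enorm_tsum_le_tsum_enorm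

omit [CompleteSpace H] in
theorem hsSq_rankOne (e : HilbertBasis ι ℂ H) (x y : H) :
    hsSq e (rankOne ℂ x y) = (‖x‖ₑ * ‖y‖ₑ) ^ 2 := by
  rw [hsSq, mul_pow, ← tsum_enorm_inner_sq e y, ← ENNReal.tsum_mul_left]
  refine tsum_congr fun j => ?_
  rw [InnerProductSpace.rankOne_apply, enorm_smul, mul_pow, mul_comm, ← inner_conj_symm,
    RCLike.enorm_conj]

theorem hsNorm_rankOne (e : HilbertBasis ι ℂ H) (x y : H) :
    hsNorm e (rankOne ℂ x y) = ‖x‖ₑ * ‖y‖ₑ :=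
  ENNReal.sq_injective (by simpa only [hsNorm_sq] using hsSq_rankOne e x y)

theorem hsNorm_crossCov_lt_top (e : HilbertBasis ι ℂ H) {Y Z : Ω → H} (hY : MemLp Y 2 P)
    (hZ : MemLp Z 2 P) : hsNorm e (crossCov P Y Z) < ∞ := by
  refine (hsNorm_integral_le e _).trans_lt ?_
  simp_rw [hsNorm_rankOne]
  have := (hY.norm.integrable_mul hZ.norm).2
  simpa [HasFiniteIntegral, enorm_mul] using this

theorem hsInner_eq (e : HilbertBasis ι ℂ H) (A B : H →L[ℂ] H) :
    hsInner e A B = ∑' j, ⟪A (e j), B (e j)⟫_ℂ := by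
  simp [hsInner, ContinuousLinearMap.star_eq_adjoint, ContinuousLinearMap.adjoint_inner_right]

theorem summable_inner_of_hsNorm_lt_top (e : HilbertBasis ι ℂ H) {A B : H →L[ℂ] H}
    (hA : hsNorm e A < ∞) (hB : hsNorm e B < ∞) :
    Summable fun j => ⟪A (e j), B (e j)⟫_ℂ := by
  have h : ∀ {A : H →L[ℂ] H}, hsNorm e A < ∞ → Summable fun j => ‖A (e j)‖ ^ 2 := by
    intro A hA
    have h1 : hsSq e A ≠ ∞ := by
      rw [← hsNorm_sq]; exact (ENNReal.pow_lt_top hA).ne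
    simpa using ENNReal.summable_toReal (f := fun j => ‖A (e j)‖ₑ ^ 2) h1
  refine Summable.of_norm_bounded ((h hA).add (h hB)) fun j => ?_
  refine (norm_inner_le_norm _ _).trans ?_
  nlinarith [sq_nonneg (‖A (e j)‖ - ‖B (e j)‖), sq_nonneg ‖A (e j)‖, sq_nonneg ‖B (e j)‖]

theorem enorm_hsInner_le (e : HilbertBasis ι ℂ H) (A B : H →L[ℂ] H) :
    ‖hsInner e A B‖ₑ ≤ hsNorm e A * hsNorm e B := by
  rw [hsInner_eq]
  refine enorm_tsum_le_tsum_enorm.trans ?_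
  rw [ENNReal.tsum_eq_iSup_sum]
  refine iSup_le fun J => ?_
  calc ∑ j ∈ J, ‖⟪A (e j), B (e j)⟫_ℂ‖ₑ ≤ ∑ j ∈ J, ‖A (e j)‖ₑ * ‖B (e j)‖ₑ := by
        gcongr; exact enorm_inner_le_mul _ _
    _ ≤ _ := ENNReal.inner_le_Lp_mul_Lq J _ _ Real.HolderConjugate.two_two
    _ ≤ _ := by
        rw [hsNorm_eq, hsNorm_eq, hsSq, hsSq]
        simp only [ENNReal.rpow_ofNat]
        gcongr <;> exact ENNReal.sum_le_tsum J

omit [CompleteSpace H] in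
theorem hasSum_inner_rankOne (e : HilbertBasis ι ℂ H) (a b c d : H) :
    HasSum (fun j => ⟪rankOne ℂ a b (e j), rankOne ℂ c d (e j)⟫_ℂ) (⟪a, c⟫_ℂ * ⟪d, b⟫_ℂ) := by
  refine ((e.hasSum_inner_mul_inner d b).mul_left ⟪a, c⟫_ℂ).congr_fun fun j => ?_
  simp only [InnerProductSpace.rankOne_apply, inner_smul_left, inner_smul_right, inner_conj_symm]
  ring

theorem hsInner_rankOne (e : HilbertBasis ι ℂ H) (a b c d : H) :
    hsInner e (rankOne ℂ a b) (rankOne ℂ c d) = ⟪a, c⟫_ℂ * ⟪d, b⟫_ℂ := by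
  rw [hsInner_eq, (hasSum_inner_rankOne e a b c d).tsum_eq]

omit [CompleteSpace H] in
theorem integrable_inner_of_memLp {V W : Ω → H} (hV : MemLp V 2 P) (hW : MemLp W 2 P) :
    Integrable (fun ω => ⟪V ω, W ω⟫_ℂ) P := by
  refine (hV.norm.integrable_mul hW.norm).mono' (hV.1.inner hW.1) ?_
  filter_upwards with ω using norm_inner_le_norm _ _

theorem integral_inner_sub_integral [IsProbabilityMeasure P] {V W : Ω → H} (hV : MemLp V 2 P)
    (hW : MemLp W 2 P) :
    ∫ ω, ⟪V ω - ∫ x, V x ∂P, W ω - ∫ x, W x ∂P⟫_ℂ ∂P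
      = ∫ ω, ⟪V ω, W ω⟫_ℂ ∂P - ⟪∫ x, V x ∂P, ∫ x, W x ∂P⟫_ℂ := by
  set m := ∫ x, V x ∂P with hm
  set m' := ∫ x, W x ∂P with hm'
  have hV1 : Integrable V P := hV.integrable one_le_two
  have hW1 : Integrable W P := hW.integrable one_le_two
  have h1 : ∫ ω, ⟪V ω - m, W ω - m'⟫_ℂ ∂P
      = ∫ ω, (⟪V ω, W ω⟫_ℂ - ⟪m, W ω⟫_ℂ) - (⟪V ω, m'⟫_ℂ - ⟪m, m'⟫_ℂ) ∂P := by
    congr with ω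
    rw [inner_sub_left, inner_sub_right, inner_sub_right]
    ring
  have h2 : ∫ ω, ⟪V ω, m'⟫_ℂ ∂P = ⟪m, m'⟫_ℂ := by
    have := integral_inner (𝕜 := ℂ) hV1 m'
    rw [← inner_conj_symm m, ← this, ← integral_conj]
    congr with ω
    rw [inner_conj_symm]
  have i1 : Integrable (fun ω => ⟪V ω, W ω⟫_ℂ) P := integrable_inner_of_memLp hV hW
  have i2 : Integrable (fun ω => ⟪m, W ω⟫_ℂ) P := hW1.const_inner m
  have i3 : Integrable (fun ω => ⟪V ω, m'⟫_ℂ) P := hV1.inner_const m'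
  have i4 : Integrable (fun ω => ⟪V ω, W ω⟫_ℂ - ⟪m, W ω⟫_ℂ) P := i1.sub i2
  have i5 : Integrable (fun ω => ⟪V ω, m'⟫_ℂ - ⟪m, m'⟫_ℂ) P := i3.sub (integrable_const _)
  rw [h1, integral_sub i4 i5, integral_sub i1 i2, integral_sub i3 (integrable_const _), h2,
    integral_inner hW1]
  simp [hm']

/-- Makes products of two `L⁴` variables available as `L²` variables. -/
instance : ENNReal.HolderTriple 4 4 2 where
  inv_add_inv_eq_inv := by
    rw [← two_mul, ← ENNReal.toReal_eq_toReal_iff' (by finiteness) (by finiteness)]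
    norm_num

/-- The second moment of a linear combination of centred dyads. -/
theorem lintegral_hsNorm_sq_sum_centered_le [IsProbabilityMeasure P] [Countable ι]
    (e : HilbertBasis ι ℂ H) {κ : Type*} (S : Finset κ) (a : κ → ℂ) {Y Z : κ → Ω → H}
    (hY : ∀ p, MemLp (Y p) 4 P) (hZ : ∀ p, MemLp (Z p) 4 P) :
    ∫⁻ ω, hsNorm e (∑ p ∈ S, a p • (rankOne ℂ (Y p ω) (Z p ω) - crossCov P (Y p) (Z p))) ^ 2 ∂P
      ≤ ∑ p ∈ S, ∑ q ∈ S, ‖a p‖ₑ * ‖a q‖ₑ *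
        ‖(∫ ω, hsInner e (rankOne ℂ (Y p ω) (Z p ω)) (rankOne ℂ (Y q ω) (Z q ω)) ∂P)
          - hsInner e (crossCov P (Y p) (Z p)) (crossCov P (Y q) (Z q))‖ₑ := by
  have hY2 : ∀ p, MemLp (Y p) 2 P := fun p => (hY p).mono_exponent (by norm_num)
  have hZ2 : ∀ p, MemLp (Z p) 2 P := fun p => (hZ p).mono_exponent (by norm_num)
  set V : κ → ι → Ω → H := fun p j ω => ⟪Z p ω, e j⟫_ℂ • Y p ω with hV
  have hVR : ∀ p j ω, rankOne ℂ (Y p ω) (Z p ω) (e j) = V p j ω := fun p j ω => by simp [hV]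
  have hVE : ∀ p j, crossCov P (Y p) (Z p) (e j) = ∫ ω, V p j ω ∂P := fun p j =>
    crossCov_apply (hY2 p) (hZ2 p) _
  have hVL : ∀ p j, MemLp (V p j) 2 P := by
    intro p j
    refine MemLp.smul (p := 4) (q := 4) (hY p) ?_
    exact (hZ p).inner_const (e j)
  set U : κ → ι → Ω → H := fun p j ω => V p j ω - ∫ x, V p j x ∂P with hU
  have hUL : ∀ p j, MemLp (U p j) 2 P := fun p j => (hVL p j).sub (memLp_const _)
  -- `k p q j` is the contribution of the basis vector `e_j` to the covariance `c p q` of two dyads;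
  -- `hkc` sums these contributions over `j`.
  set k : κ → κ → ι → ℂ := fun p q j =>
    ∫ ω, ⟪V p j ω, V q j ω⟫_ℂ ∂P - ⟪∫ x, V p j x ∂P, ∫ x, V q j x ∂P⟫_ℂ with hk
  set c : κ → κ → ℂ := fun p q =>
    (∫ ω, hsInner e (rankOne ℂ (Y p ω) (Z p ω)) (rankOne ℂ (Y q ω) (Z q ω)) ∂P)
          - hsInner e (crossCov P (Y p) (Z p)) (crossCov P (Y q) (Z q)) with hc
  have hkc : ∀ p q, HasSum (k p q) (c p q) := by
    intro p q
    refine HasSum.sub ?_ ?_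
    · simp_rw [hsInner_rankOne]
      have hprod : ∀ {A B C D : Ω → H}, MemLp A 4 P → MemLp B 4 P → MemLp C 4 P → MemLp D 4 P →
          Integrable (fun ω => (‖A ω‖ * ‖B ω‖) * (‖C ω‖ * ‖D ω‖)) P := by
        intro A B C D hA hB hC hD
        exact (MemLp.mul' (p := 4) (q := 4) (r := 2) hB.norm hA.norm).integrable_mul
          (MemLp.mul' (p := 4) (q := 4) (r := 2) hD.norm hC.norm)
      have h := hasSum_integral_inner_mul_inner e (P := P) (φ := fun ω => ⟪Y p ω, Y q ω⟫_ℂ)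
        ((hY p).1.inner (hY q).1) (hZ p).1 (hZ q).1 (by
          refine Integrable.mono' ((hprod (hY p) (hY q) (hZ p) (hZ p)).add
            (hprod (hY p) (hY q) (hZ q) (hZ q)))
            (((hY p).1.inner (hY q).1).norm.mul (((hZ p).1.norm.pow 2).add ((hZ q).1.norm.pow 2)))
            ?_
          filter_upwards with ω
          rw [Real.norm_of_nonneg (by positivity), Pi.add_apply, ← mul_add, ← sq, ← sq]
          gcongr
          exact norm_inner_le_norm _ _)
      refine h.congr_fun fun j => ?_
      congr with ω
      simp only [hV, inner_smul_left, inner_smul_right, inner_conj_symm]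
      ring
    · rw [hsInner_eq]
      simp_rw [← hVE]
      exact (summable_inner_of_hsNorm_lt_top e (hsNorm_crossCov_lt_top e (hY2 p) (hZ2 p))
        (hsNorm_crossCov_lt_top e (hY2 q) (hZ2 q))).hasSum
  have hG : ∀ j ω, (∑ p ∈ S, a p • (rankOne ℂ (Y p ω) (Z p ω) - crossCov P (Y p) (Z p))) (e j)
      = ∑ p ∈ S, a p • U p j ω := by
    intro j ω
    rw [sum_apply]
    refine Finset.sum_congr rfl fun p _ => ?_
    rw [smul_apply, sub_apply, hVR, hVE]
  have hGL : ∀ j, MemLp (fun ω => ∑ p ∈ S, a p • U p j ω) 2 P := fun j =>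
    memLp_finsetSum S fun p _ => (hUL p j).const_smul (a p)
  -- The square is expanded for each `e_j` separately, where all vectors lie in `H`; only afterwards
  -- are the finite double sums summed over `j`.
  have hj : ∀ j, ∫ ω, ‖∑ p ∈ S, a p • U p j ω‖ ^ 2 ∂P
      = RCLike.re (∑ p ∈ S, ∑ q ∈ S, (starRingEnd ℂ (a p) * a q) * k p q j) := by
    intro j
    have h1 : ∀ ω, ((‖∑ p ∈ S, a p • U p j ω‖ ^ 2 : ℝ) : ℂ)
        = ∑ p ∈ S, ∑ q ∈ S, (starRingEnd ℂ (a p) * a q) * ⟪U p j ω, U q j ω⟫_ℂ := by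
      intro ω
      have h2 := inner_self_eq_norm_sq_to_K (𝕜 := ℂ) (∑ p ∈ S, a p • U p j ω)
      push_cast
      refine h2.symm.trans ?_
      rw [sum_inner]
      refine Finset.sum_congr rfl fun p _ => ?_
      rw [inner_sum]
      refine Finset.sum_congr rfl fun q _ => ?_
      rw [inner_smul_left, inner_smul_right, mul_assoc]
    have h3 : ((∫ ω, ‖∑ p ∈ S, a p • U p j ω‖ ^ 2 ∂P : ℝ) : ℂ)
        = ∑ p ∈ S, ∑ q ∈ S, (starRingEnd ℂ (a p) * a q) * k p q j := by
      rw [← integral_complex_ofReal]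
      simp_rw [h1]
      rw [integral_finsetSum]
      · refine Finset.sum_congr rfl fun p _ => ?_
        rw [integral_finsetSum]
        · refine Finset.sum_congr rfl fun q _ => ?_
          rw [integral_const_mul, hU, integral_inner_sub_integral (hVL p j) (hVL q j)]
        · exact fun q _ => (integrable_inner_of_memLp (hUL p j) (hUL q j)).const_mul _
      · exact fun p _ => integrable_finsetSum _ fun q _ =>
          (integrable_inner_of_memLp (hUL p j) (hUL q j)).const_mul _
    rw [← h3]
    simp
  have hsum : HasSum (fun j => ∫ ω, ‖∑ p ∈ S, a p • U p j ω‖ ^ 2 ∂P)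
      (RCLike.re (∑ p ∈ S, ∑ q ∈ S, (starRingEnd ℂ (a p) * a q) * c p q)) := by
    simp_rw [hj]
    refine (RCLike.reCLM (K := ℂ)).hasSum ?_
    exact hasSum_sum fun p _ => hasSum_sum fun q _ => (hkc p q).mul_left _
  have hlhs : ∫⁻ ω, hsNorm e (∑ p ∈ S, a p • (rankOne ℂ (Y p ω) (Z p ω)
      - crossCov P (Y p) (Z p))) ^ 2 ∂P
      = ∑' j, ENNReal.ofReal (∫ ω, ‖∑ p ∈ S, a p • U p j ω‖ ^ 2 ∂P) := by
    simp_rw [hsNorm_sq, hsSq, hG]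
    rw [lintegral_tsum fun j => (hGL j).1.enorm.pow_const 2]
    refine tsum_congr fun j => ?_
    rw [ofReal_integral_eq_lintegral_ofReal (hGL j).norm.integrable_sq
      (ae_of_all _ fun _ => by positivity)]
    simp_rw [ENNReal.ofReal_pow (norm_nonneg _), ofReal_norm]
  rw [hlhs, ← ENNReal.ofReal_tsum_of_nonneg (fun j => integral_nonneg fun _ => by positivity)
    hsum.summable, hsum.tsum_eq]
  refine (ENNReal.ofReal_le_ofReal (RCLike.re_le_norm _)).trans ?_
  rw [ofReal_norm]
  refine (enorm_sum_le _ _).trans (Finset.sum_le_sum fun p _ => ?_)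
  refine (enorm_sum_le _ _).trans (Finset.sum_le_sum fun q _ => ?_)
  rw [enorm_mul, enorm_mul, RCLike.enorm_conj]

end SecondOrder

/-! ### Covariances of dyads through the cumulant and the covariance function. -/

section CovarianceBounds

variable {H : Type*} [NormedAddCommGroup H] [InnerProductSpace ℂ H] [CompleteSpace H]
  {ι Ω : Type*} [MeasurableSpace Ω] {P : Measure Ω} {d : ℕ} {e : HilbertBasis ι ℂ H}
  {X : Pt d → Ω → H}

open InnerProductSpace (rankOne)

omit [CompleteSpace H] in
theorem crossCov_congr {Y Y' Z Z' : Ω → H} (hY : Y =ᵐ[P] Y') (hZ : Z =ᵐ[P] Z') :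
    crossCov P Y Z = crossCov P Y' Z' := by
  refine integral_congr_ae ?_
  filter_upwards [hY, hZ] with ω h1 h2
  rw [h1, h2]

omit [CompleteSpace H] in
theorem IsStationaryRealProcess.crossCov_eq (hX : IsStationaryRealProcess e P X) (t s : Pt d) :
    crossCov P (X t) (X s) = covOp P X (t - s) := by
  have := hX.cov_shift t s (-s)
  rw [covOp, ← this]
  simp [sub_eq_add_neg]

/-- The size of the covariance operator at lag `h`, controlling its trace and its
Hilbert-Schmidt norm. -/
noncomputable def covSize (e : HilbertBasis ι ℂ H) (P : Measure Ω) (X : Pt d → Ω → H)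
    (h : Pt d) : ℝ≥0∞ :=
  diagNorm e (covOp P X h) + hsNorm e (covOp P X h)

/-- The covariance of two dyads is bounded through the fourth-order cumulant. -/
theorem IsStationaryRealProcess.enorm_cov_rankOne_le [Countable ι]
    (hX : IsStationaryRealProcess e P X) (t s t' s' : Pt d) :
    ‖(∫ ω, hsInner e (rankOne ℂ (X t ω) (X s ω)) (rankOne ℂ (X t' ω) (X s' ω)) ∂P)
        - hsInner e (crossCov P (X t) (X s)) (crossCov P (X t') (X s'))‖ₑ
      ≤ ‖cum4 e P (X t) (X s) (X t') (X s')‖ₑ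
        + covSize e P X (t' - t) * covSize e P X (s - s')
        + covSize e P X (t - s') * covSize e P X (t' - s) := by
  have h1 : (∫ ω, hsInner e (rankOne ℂ (X t ω) (X s ω)) (rankOne ℂ (X t' ω) (X s' ω)) ∂P)
        - hsInner e (crossCov P (X t) (X s)) (crossCov P (X t') (X s'))
      = cum4 e P (X t) (X s) (X t') (X s')
        + (∫ ω, ⟪X t ω, X t' ω⟫_ℂ ∂P) * (∫ ω, ⟪X s' ω, X s ω⟫_ℂ ∂P)
        + hsInner e (crossCov P (X t) (fun ω => conjVec e (X s' ω)))
            (crossCov P (X t') (fun ω => conjVec e (X s ω))) := by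
    rw [cum4]; ring
  rw [h1]
  refine (enorm_add_le _ _).trans (add_le_add ((enorm_add_le _ _).trans (add_le_add le_rfl ?_)) ?_)
  · rw [enorm_mul]
    refine mul_le_mul' ?_ ?_
    · refine (enorm_integral_inner_le_diagNorm e (hX.memLp_two t') (hX.memLp_two t)).trans ?_
      rw [hX.crossCov_eq]
      exact le_self_add
    · refine (enorm_integral_inner_le_diagNorm e (hX.memLp_two s) (hX.memLp_two s')).trans ?_
      rw [hX.crossCov_eq]
      exact le_self_add
  · refine (enorm_hsInner_le e _ _).trans (mul_le_mul' ?_ ?_)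
    -- Reality of the process removes the conjugation and turns the pseudo-covariance into an
    -- ordinary covariance at a lag.
    · rw [crossCov_congr (Filter.EventuallyEq.refl _ _) (hX.real s'), hX.crossCov_eq]
      exact le_add_self
    · rw [crossCov_congr (Filter.EventuallyEq.refl _ _) (hX.real s), hX.crossCov_eq]
      exact le_add_self

/-- Compares a lattice lag with the other points of its cell. It uses subadditivity of the two
summands of `covSize`; the trace norm only bounds the increment, so neither its triangle inequality
nor its measurability is needed. -/
theorem covSize_le_add (e : HilbertBasis ι ℂ H) (x y : Pt d) :
    covSize e P X y
      ≤ covSize e P X x + 2 * traceNorm e (covOp P X y - covOp P X x) := by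
  have h1 : diagNorm e (covOp P X y)
      ≤ diagNorm e (covOp P X x) + traceNorm e (covOp P X y - covOp P X x) := by
    refine le_trans ?_ (add_le_add_right (diagNorm_le_traceNorm e _) _)
    simpa using diagNorm_add_le e (covOp P X x) (covOp P X y - covOp P X x)
  have h2 : hsNorm e (covOp P X y)
      ≤ hsNorm e (covOp P X x) + traceNorm e (covOp P X y - covOp P X x) := by
    refine le_trans ?_ (add_le_add_right (hsNorm_le_traceNorm e _) _)
    simpa using hsNorm_add_le e (covOp P X x) (covOp P X y - covOp P X x)
  refine (add_le_add h1 h2).trans_eq ?_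
  rw [covSize]
  ring

theorem aemeasurable_covSize [Countable ι] (hC : AEStronglyMeasurable (covOp P X) volume) :
    AEMeasurable (covSize e P X) volume :=
  (aemeasurable_diagNorm e hC).add (aemeasurable_hsNorm e hC)

theorem lintegral_covSize_lt_top [Countable ι] (hC : AEStronglyMeasurable (covOp P X) volume)
    (hint : ∫⁻ h, traceNorm e (covOp P X h) < ∞) : ∫⁻ h, covSize e P X h < ∞ := by
  simp_rw [covSize]
  rw [lintegral_add_left' (aemeasurable_diagNorm e hC)]
  refine ENNReal.add_lt_top.2 ⟨?_, ?_⟩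
  · exact (lintegral_mono fun h => diagNorm_le_traceNorm e _).trans_lt hint
  · exact (lintegral_mono fun h => hsNorm_le_traceNorm e _).trans_lt hint

/-- The Bochner integrability contained in a trace norm bound. -/
theorem integrable_of_lintegral_traceNorm {C : Pt d → H →L[ℂ] H}
    (hC : AEStronglyMeasurable C volume) (hint : ∫⁻ h, traceNorm e (C h) < ∞) :
    Integrable C :=
  ⟨hC, (lintegral_mono fun _ =>
    (enorm_le_hsNorm e _).trans (hsNorm_le_traceNorm e _)).trans_lt hint⟩

end CovarianceBounds

/-! ### Lattice cells, boxes and counting of pairs. -/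

section Grid

variable {d : ℕ}

/-- The lattice point with index `k` and mesh `δ`. -/
noncomputable def latticePt (δ : ℝ) (k : Fin d → ℤ) : Pt d := WithLp.toLp 2 fun l => (k l : ℝ) * δ

/-- The index of the lattice cell containing `x`. -/
noncomputable def cellIdx (δ : ℝ) (x : Pt d) : Fin d → ℤ := fun l => ⌊x l / δ⌋

/-- The indices of the observation grid. -/
noncomputable def gridIdx (N : Fin d → ℕ) : Finset (Fin d → ℤ) :=
  Fintype.piFinset fun l => Finset.Icc 1 (N l : ℤ)

theorem latticePt_apply (δ : ℝ) (k : Fin d → ℤ) (l : Fin d) : latticePt δ k l = k l * δ := rfl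

theorem latticePt_sub (δ : ℝ) (k k' : Fin d → ℤ) :
    latticePt δ (k - k') = latticePt δ k - latticePt δ k' := by
  ext l; simp [latticePt, sub_mul]

theorem latticePt_injective {δ : ℝ} (hδ : 0 < δ) :
    Function.Injective (latticePt δ : (Fin d → ℤ) → Pt d) := by
  intro k k' h
  ext l
  have h1 : (k l : ℝ) * δ = k' l * δ := congrArg (fun x : Pt d => x l) h
  exact_mod_cast mul_right_cancel₀ hδ.ne' h1

theorem gridPoints_eq (δ : ℝ) (N : Fin d → ℕ) :
    (gridPoints δ N : Set (Pt d)) = latticePt δ '' (gridIdx N : Set (Fin d → ℤ)) := by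
  classical
  ext x
  simp only [gridPoints, gridIdx, Finset.coe_image, Set.mem_image, Finset.mem_coe,
    Fintype.mem_piFinset, Finset.mem_Icc]
  constructor
  · rintro ⟨k, hk, rfl⟩
    exact ⟨fun l => k l, fun l => ⟨Int.ofNat_le.2 (hk l).1, Int.ofNat_le.2 (hk l).2⟩,
      by simp [latticePt]⟩
  · rintro ⟨k, hk, rfl⟩
    refine ⟨fun l => (k l).toNat, fun l => ?_, ?_⟩
    · have := hk l
      dsimp only
      constructor <;> omega
    · ext l
      have : ((k l).toNat : ℤ) = k l := Int.toNat_of_nonneg (by have := hk l; omega)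
      have h2 : (((k l).toNat : ℕ) : ℝ) = (k l : ℝ) := by exact_mod_cast this
      simp [latticePt, h2]

theorem sum_gridPoints {δ : ℝ} (hδ : 0 < δ) (N : Fin d → ℕ) {M : Type*} [AddCommMonoid M]
    (F : Pt d → M) : ∑ t ∈ gridPoints δ N, F t = ∑ k ∈ gridIdx N, F (latticePt δ k) := by
  classical
  have h : gridPoints δ N = (gridIdx N).image (latticePt δ) := by
    apply Finset.coe_injective
    rw [gridPoints_eq, Finset.coe_image]
  rw [h, Finset.sum_image fun k _ k' _ hk => latticePt_injective hδ hk]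

theorem norm_latticePt_cellIdx_sub_le {δ : ℝ} (hδ : 0 < δ) (x : Pt d) :
    ‖latticePt δ (cellIdx δ x) - x‖ ≤ √d * δ := by
  rw [EuclideanSpace.norm_eq]
  have h : ∀ l, ‖(latticePt δ (cellIdx δ x) - x) l‖ ^ 2 ≤ δ ^ 2 := by
    intro l
    refine pow_le_pow_left₀ (norm_nonneg _) ?_ 2
    rw [PiLp.sub_apply, latticePt_apply, cellIdx, Real.norm_eq_abs]
    have h1 := Int.floor_le (x l / δ)
    have h2 := Int.lt_floor_add_one (x l / δ)
    rw [le_div_iff₀ hδ] at h1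
    rw [div_lt_iff₀ hδ] at h2
    rw [abs_le]
    constructor <;> nlinarith
  calc _ ≤ √(∑ _l : Fin d, δ ^ 2) := Real.sqrt_le_sqrt (Finset.sum_le_sum fun l _ => h l)
    _ = √d * δ := by
      rw [Finset.sum_const, Finset.card_univ, Fintype.card_fin, nsmul_eq_mul,
        Real.sqrt_mul (by positivity), Real.sqrt_sq hδ.le]

theorem measurable_cellIdx (δ : ℝ) : Measurable (cellIdx δ : Pt d → Fin d → ℤ) := by
  refine measurable_pi_lambda _ fun l => Int.measurable_floor.comp ?_
  exact ((EuclideanSpace.proj (𝕜 := ℝ) l).continuous.measurable).div_const δ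

/-- The closed box with opposite corners `p` and `q`. -/
def closedBox (p q : Fin d → ℝ) : Set (Pt d) := {x | ∀ l, p l ≤ x l ∧ x l ≤ q l}

theorem closedBox_eq_preimage (p q : Fin d → ℝ) :
    closedBox p q = (WithLp.ofLp : Pt d → Fin d → ℝ) ⁻¹' Set.Icc p q := by
  ext x
  simp [closedBox, Pi.le_def, forall_and]

theorem volume_closedBox (p q : Fin d → ℝ) :
    volume (closedBox p q) = ∏ l, ENNReal.ofReal (q l - p l) := by
  rw [closedBox_eq_preimage, (PiLp.volume_preserving_ofLp (Fin d)).measure_preimage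
    measurableSet_Icc.nullMeasurableSet, Real.volume_Icc_pi]

theorem volume_real_closedBox {p q : Fin d → ℝ} (h : ∀ l, p l ≤ q l) :
    volume.real (closedBox p q) = ∏ l, (q l - p l) := by
  rw [measureReal_def, volume_closedBox, ENNReal.toReal_prod]
  exact Finset.prod_congr rfl fun l _ => ENNReal.toReal_ofReal (by linarith [h l])

/-- The preimage of an index is a half-open cube of side `δ`. This turns lattice sums weighted by
`δ^d` into integrals of functions constant on cells. -/
theorem map_cellIdx_volume {δ : ℝ} (hδ : 0 < δ) :
    Measure.map (cellIdx δ) (volume : Measure (Pt d))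
      = ENNReal.ofReal (δ ^ d) • (Measure.count : Measure (Fin d → ℤ)) := by
  refine Measure.ext_of_singleton fun k => ?_
  rw [Measure.map_apply (measurable_cellIdx δ) (MeasurableSet.singleton k), Measure.smul_apply,
    Measure.count_singleton]
  have h : cellIdx δ ⁻¹' {k} = (WithLp.ofLp : Pt d → Fin d → ℝ) ⁻¹'
      (Set.univ.pi fun l => Set.Ico ((k l : ℝ) * δ) ((k l + 1) * δ)) := by
    ext x
    simp only [Set.mem_preimage, Set.mem_singleton_iff, funext_iff, cellIdx, Set.mem_pi,
      Set.mem_univ, true_implies, Set.mem_Ico]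
    refine forall_congr' fun l => ?_
    rw [Int.floor_eq_iff, le_div_iff₀ hδ, div_lt_iff₀ hδ]
  rw [h, (PiLp.volume_preserving_ofLp (Fin d)).measure_preimage
    (MeasurableSet.univ_pi fun _ => measurableSet_Ico).nullMeasurableSet, Real.volume_pi_Ico]
  have h2 : ∀ l, ((k l : ℝ) + 1) * δ - k l * δ = δ := fun l => by ring
  simp [h2, ENNReal.ofReal_pow hδ.le]

theorem lintegral_comp_cellIdx {δ : ℝ} (hδ : 0 < δ) (F : (Fin d → ℤ) → ℝ≥0∞) :
    ∫⁻ x : Pt d, F (cellIdx δ x) = ENNReal.ofReal (δ ^ d) * ∑' k, F k := by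
  rw [← lintegral_map (measurable_of_countable F) (measurable_cellIdx δ), map_cellIdx_volume hδ,
    lintegral_smul_measure, lintegral_count, smul_eq_mul]

theorem integrable_comp_cellIdx {δ : ℝ} (hδ : 0 < δ) {E : Type*} [NormedAddCommGroup E]
    {F : (Fin d → ℤ) → E} (S : Finset (Fin d → ℤ)) (hF : ∀ k ∉ S, F k = 0) :
    Integrable fun x : Pt d => F (cellIdx δ x) := by
  constructor
  · exact (StronglyMeasurable.of_discrete (f := F)).comp_measurable
      (measurable_cellIdx δ) |>.aestronglyMeasurable
  · rw [HasFiniteIntegral, lintegral_comp_cellIdx hδ fun k => ‖F k‖ₑ,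
      tsum_eq_sum (s := S) fun k hk => by simp [hF k hk]]
    exact ENNReal.mul_lt_top ENNReal.ofReal_lt_top (ENNReal.sum_lt_top.2 fun _ _ => enorm_lt_top)

theorem integral_comp_cellIdx {δ : ℝ} (hδ : 0 < δ) {E : Type*} [NormedAddCommGroup E]
    [NormedSpace ℝ E] [CompleteSpace E]
    {F : (Fin d → ℤ) → E} (S : Finset (Fin d → ℤ)) (hF : ∀ k ∉ S, F k = 0) :
    ∫ x : Pt d, F (cellIdx δ x) = δ ^ d • ∑ k ∈ S, F k := by
  have hi := integrable_comp_cellIdx hδ S hF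
  have hm : AEStronglyMeasurable F (Measure.map (cellIdx δ) (volume : Measure (Pt d))) :=
    (StronglyMeasurable.of_discrete (f := F)).aestronglyMeasurable
  rw [← integral_map (measurable_cellIdx δ).aemeasurable hm]
  rw [map_cellIdx_volume hδ, integral_smul_measure, ENNReal.toReal_ofReal (by positivity)]
  congr 1
  have h1 : ∫ k, F k ∂Measure.count = ∫ k in (S : Set (Fin d → ℤ)), F k ∂Measure.count := by
    rw [setIntegral_eq_integral_of_forall_compl_eq_zero fun k hk => hF k (by simpa using hk)]
  have h2 : Integrable F (Measure.count : Measure (Fin d → ℤ)) := by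
    have h3 := (integrable_map_measure hm (measurable_cellIdx δ).aemeasurable).2 hi
    rw [map_cellIdx_volume hδ] at h3
    exact (integrable_smul_measure (by simpa using pow_pos hδ d) ENNReal.ofReal_ne_top).1 h3
  rw [h1, setIntegral_finset S h2.integrableOn]
  simp [measureReal_def]

/-- The number of pairs of grid indices with difference `m`. -/
theorem card_filter_sub_eq (N : Fin d → ℕ) (m : Fin d → ℤ) :
    ((gridIdx N ×ˢ gridIdx N).filter fun p => p.1 - p.2 = m).card
      = ∏ l, ((N l : ℤ) - |m l|).toNat := by
  classical
  -- Pairs with difference `m` are `(k + m, k)` with each `k l` in an interval of `N l - |m l|`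
  -- integers; `toNat` gives the correct count `0` for lags beyond the grid.
  have h : ((gridIdx N ×ˢ gridIdx N).filter fun p => p.1 - p.2 = m)
      = (Fintype.piFinset fun l => Finset.Icc (max 1 (1 - m l)) (min (N l : ℤ) (N l - m l))).image
        fun k => (k + m, k) := by
    ext ⟨k, k'⟩
    simp only [gridIdx, Finset.mem_filter, Finset.mem_product, Fintype.mem_piFinset,
      Finset.mem_Icc, Finset.mem_image, Prod.mk.injEq]
    constructor
    · rintro ⟨⟨h1, h2⟩, rfl⟩
      refine ⟨k', fun l => ?_, by simp, rfl⟩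
      have := h1 l; have := h2 l
      simp only [Pi.sub_apply]
      omega
    · rintro ⟨k'', h1, rfl, rfl⟩
      refine ⟨⟨fun l => ?_, fun l => ?_⟩, by simp⟩
      · have := h1 l
        simp only [Pi.add_apply]
        omega
      · have := h1 l
        omega
  rw [h, Finset.card_image_of_injective _ fun a b hab => (Prod.mk.inj hab).2,
    Fintype.card_piFinset]
  refine Finset.prod_congr rfl fun l _ => ?_
  rw [Int.card_Icc]
  congr 1
  rcases abs_cases (m l) with ⟨h1, h2⟩ | ⟨h1, h2⟩ <;> rw [h1] <;> omega

/-- Grouping a double sum over the grid by differences. -/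
theorem sum_sum_gridIdx_sub (N : Fin d → ℕ) {E : Type*} [AddCommMonoid E]
    (F : (Fin d → ℤ) → E) :
    ∑ k ∈ gridIdx N, ∑ k' ∈ gridIdx N, F (k - k')
      = ∑ m ∈ Fintype.piFinset fun l => Finset.Icc (-(N l : ℤ)) (N l),
          (∏ l, ((N l : ℤ) - |m l|).toNat) • F m := by
  classical
  rw [← Finset.sum_product',
    ← Finset.sum_fiberwise_of_maps_to (s := gridIdx N ×ˢ gridIdx N)
      (t := Fintype.piFinset fun l => Finset.Icc (-(N l : ℤ)) (N l)) (g := fun p => p.1 - p.2)]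
  · refine Finset.sum_congr rfl fun m _ => ?_
    rw [← card_filter_sub_eq, ← Finset.sum_const]
    refine Finset.sum_congr rfl fun p hp => ?_
    rw [(Finset.mem_filter.1 hp).2]
  · rintro ⟨k, k'⟩ hk
    simp only [gridIdx, Finset.mem_product, Fintype.mem_piFinset, Finset.mem_Icc] at hk ⊢
    intro l
    have := hk.1 l; have := hk.2 l
    simp only [Pi.sub_apply]
    omega

theorem closedBox_inter_shift (p q : Fin d → ℝ) (h : Pt d) :
    closedBox p q ∩ (fun x => x - h) '' closedBox p q
      = closedBox (fun l => max (p l) (p l - h l)) (fun l => min (q l) (q l - h l)) := by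
  ext x
  simp only [closedBox, Set.mem_inter_iff, Set.mem_ofPred_eq, Set.mem_image, max_le_iff,
    le_min_iff]
  constructor
  · rintro ⟨h1, y, h2, rfl⟩ l
    have := h1 l; have := h2 l
    simp only [PiLp.sub_apply] at *
    constructor <;> constructor <;> linarith
  · intro h1
    refine ⟨fun l => ⟨(h1 l).1.1, (h1 l).2.1⟩, x + h, fun l => ?_, by simp⟩
    have := h1 l
    simp only [PiLp.add_apply]
    constructor <;> linarith

theorem volume_real_closedBox_inter_shift {p q : Fin d → ℝ} {h : Pt d}
    (hh : ∀ l, |h l| ≤ q l - p l) :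
    volume.real (closedBox p q ∩ (fun x => x - h) '' closedBox p q)
      = ∏ l, (q l - p l - |h l|) := by
  have hl : ∀ l, min (q l) (q l - h l) - max (p l) (p l - h l) = q l - p l - |h l| := by
    intro l
    rcases abs_cases (h l) with ⟨h1, h2⟩ | ⟨h1, h2⟩
    · rw [h1, min_eq_right (by linarith), max_eq_left (by linarith)]; ring
    · rw [h1, min_eq_left (by linarith), max_eq_right (by linarith)]; ring
  rw [closedBox_inter_shift, volume_real_closedBox]
  · exact Finset.prod_congr rfl fun l _ => hl l
  · intro l
    have := hl l; have := hh l
    linarith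

/-- The convex hull of a product is the product of the hulls, each an interval from `δ` to `N l *
δ`, and the resulting box is already closed. -/
theorem gridHull_eq_closedBox {δ : ℝ} (hδ : 0 < δ) {N : Fin d → ℕ} (hN : ∀ l, 1 ≤ N l) :
    gridHull δ N = closedBox (fun _ => δ) (fun l => N l * δ) := by
  have h1 : (gridPoints δ N : Set (Pt d)) = (WithLp.linearEquiv 2 ℝ (Fin d → ℝ)).symm ''
      (Set.univ.pi fun l => (fun k : ℕ => (k : ℝ) * δ) '' Set.Icc 1 (N l)) := by
    classical
    ext x
    simp only [gridPoints, Finset.coe_image, Set.mem_image, Finset.mem_coe, Fintype.mem_piFinset,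
      Finset.mem_Icc, Set.mem_pi, Set.mem_univ, true_implies, Set.mem_Icc]
    constructor
    · rintro ⟨k, hk, rfl⟩
      exact ⟨fun l => k l * δ, fun l => ⟨k l, hk l, rfl⟩, rfl⟩
    · rintro ⟨y, hy, rfl⟩
      choose k hk hk' using hy
      exact ⟨k, hk, by simp [hk']⟩
  have h2 : ∀ l, convexHull ℝ ((fun k : ℕ => (k : ℝ) * δ) '' Set.Icc 1 (N l))
      = Set.Icc δ (N l * δ) := by
    intro l
    have hle : δ ≤ N l * δ := by
      have : (1 : ℝ) ≤ N l := by exact_mod_cast hN l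
      nlinarith
    refine Set.Subset.antisymm (convexHull_min ?_ (convex_Icc _ _)) ?_
    · rintro _ ⟨k, ⟨hk1, hk2⟩, rfl⟩
      have h3 : (1 : ℝ) ≤ k := by exact_mod_cast hk1
      have h4 : (k : ℝ) ≤ N l := by exact_mod_cast hk2
      constructor <;> simp only <;> nlinarith
    · rw [← segment_eq_Icc hle]
      refine segment_subset_convexHull ⟨1, ⟨le_rfl, hN l⟩, by simp⟩ ⟨N l, ⟨hN l, le_rfl⟩, rfl⟩
  have h3 : convexHull ℝ (gridPoints δ N : Set (Pt d))
      = closedBox (fun _ => δ) (fun l => N l * δ) := by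
    rw [h1, ← LinearEquiv.coe_coe, ← LinearMap.image_convexHull, convexHull_pi]
    simp_rw [h2]
    ext x
    simp only [LinearEquiv.coe_coe, Set.mem_image, Set.mem_pi, Set.mem_univ, true_implies,
      Set.mem_Icc, closedBox, Set.mem_ofPred_eq]
    constructor
    · rintro ⟨y, hy, rfl⟩ l
      exact hy l
    · intro hx
      exact ⟨WithLp.ofLp x, hx, rfl⟩
  rw [gridHull, closedConvexHull_eq_closure_convexHull, h3]
  refine IsClosed.closure_eq ?_
  rw [closedBox_eq_preimage]
  exact isClosed_Icc.preimage (PiLp.continuous_ofLp 2 _)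

theorem gridPoints_eq_empty {δ : ℝ} {N : Fin d → ℕ} (hN : ¬∀ l, 1 ≤ N l) :
    gridPoints δ N = ∅ := by
  classical
  push Not at hN
  obtain ⟨l, hl⟩ := hN
  rw [gridPoints, Finset.image_eq_empty, Finset.eq_empty_iff_forall_notMem]
  intro k hk
  have := Finset.mem_Icc.1 (Fintype.mem_piFinset.1 hk l)
  omega

end Grid

/-! ### Taylor and Lipschitz bounds for the kernel from partial derivatives. -/

section PartialDerivatives

variable {d : ℕ}

/-- The coordinate path from `y` to `x`: the first `m` coordinates of `x`, the others from `y`. -/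
def coordPath (x y : Pt d) (m : ℕ) : Pt d := WithLp.toLp 2 fun i => if (i : ℕ) < m then x i else y i

theorem coordPath_zero (x y : Pt d) : coordPath x y 0 = y := by
  ext i; simp [coordPath]

theorem coordPath_self (x y : Pt d) : coordPath x y d = x := by
  ext i; simp [coordPath]

theorem coordPath_succ (x y : Pt d) (i : Fin d) :
    coordPath x y (i + 1) = coordPath x y i + (x i - y i) • EuclideanSpace.single i (1 : ℝ) := by
  ext j
  by_cases h : j = i
  · subst h; simp [coordPath]
  · have h' : (j : ℕ) ≠ i := fun h2 => h (Fin.ext h2)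
    have : j ≤ i ↔ j < i := by rw [Fin.le_def, Fin.lt_def]; omega
    simp [coordPath, h, this]

/-- The mean value inequality along coordinate directions. -/
theorem abs_sub_le_of_partial_le {g : Pt d → ℝ} {M : ℝ} (x y : Pt d)
    (hg : ∀ i z, LineDifferentiableAt ℝ g z (EuclideanSpace.single i 1))
    (hM : ∀ (i : Fin d) (s : ℝ), s ∈ Set.Icc (0 : ℝ) 1 →
      |lineDeriv ℝ g (coordPath x y i + (s * (x i - y i)) • EuclideanSpace.single i (1 : ℝ))
        (EuclideanSpace.single i 1)| ≤ M) :
    |g x - g y| ≤ d * (M * ‖x - y‖) := by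
  -- Only differentiability along the axes is available, so the increment is split along a path
  -- changing one coordinate at a time, and each leg is a one-variable mean value inequality.
  have hstep : ∀ i : Fin d, |g (coordPath x y (i + 1)) - g (coordPath x y i)| ≤ M * ‖x - y‖ := by
    intro i
    set v : Pt d := EuclideanSpace.single i 1
    set c := x i - y i
    have hder : ∀ s : ℝ, HasDerivAt (fun s : ℝ => g (coordPath x y i + (s * c) • v))
        (lineDeriv ℝ g (coordPath x y i + (s * c) • v) v * c) s := by
      intro s
      have h1 : HasDerivAt (fun t : ℝ => g (coordPath x y i + (s * c) • v + t • v))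
          (lineDeriv ℝ g (coordPath x y i + (s * c) • v) v) ((s - s) * c) := by
        rw [sub_self, zero_mul]
        exact (hg i (coordPath x y i + (s * c) • v)).hasLineDerivAt
      have h2 : HasDerivAt (fun r : ℝ => (r - s) * c) c s := by
        simpa using ((hasDerivAt_id s).sub_const s).mul_const c
      have h3 := HasDerivAt.scomp s h1 h2
      rw [mul_comm]
      refine h3.congr_of_eventuallyEq (Eventually.of_forall fun r => ?_)
      simp only [Function.comp]
      rw [add_assoc, ← add_smul]
      congr 3
      ring
    have h4 := norm_image_sub_le_of_norm_deriv_le_segment_01'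
      (f := fun s : ℝ => g (coordPath x y i + (s * c) • v)) (C := M * |c|)
      (fun s _ => (hder s).hasDerivWithinAt) (fun s hs => by
        rw [Real.norm_eq_abs, abs_mul]
        gcongr
        exact hM i s ⟨hs.1, hs.2.le⟩)
    have hM0 : 0 ≤ M := (abs_nonneg _).trans (hM i 0 ⟨le_rfl, zero_le_one⟩)
    have h5 : |c| ≤ ‖x - y‖ := by
      have := PiLp.norm_apply_le (x - y) i
      simpa [c] using this
    simp only [one_mul, zero_mul, zero_smul, add_zero, Real.norm_eq_abs] at h4
    rw [coordPath_succ]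
    exact h4.trans (by gcongr)
  have htel : g x - g y = ∑ i : Fin d, (g (coordPath x y (i + 1)) - g (coordPath x y i)) := by
    rw [Fin.sum_univ_eq_sum_range (fun i => g (coordPath x y (i + 1)) - g (coordPath x y i)),
      Finset.sum_range_sub (fun i => g (coordPath x y i)), coordPath_self, coordPath_zero]
  rw [htel]
  refine (Finset.abs_sum_le_sum_abs _ _).trans ((Finset.sum_le_sum fun i _ => hstep i).trans ?_)
  simp

/-- Keeps the path from `0` to `x` inside the ball of radius `‖x‖`, so that a bound `M ‖·‖ ^ k` on
derivatives becomes `M ‖x‖ ^ k` along it. -/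
theorem norm_coordPath_zero_le (x : Pt d) (i : Fin d) {s : ℝ} (hs : s ∈ Set.Icc (0 : ℝ) 1) :
    ‖coordPath x 0 i + (s * (x i - (0 : Pt d) i)) • EuclideanSpace.single i (1 : ℝ)‖ ≤ ‖x‖ := by
  rw [EuclideanSpace.norm_eq, EuclideanSpace.norm_eq]
  refine Real.sqrt_le_sqrt (Finset.sum_le_sum fun j _ => ?_)
  refine pow_le_pow_left₀ (norm_nonneg _) ?_ 2
  by_cases h : j = i
  · subst h
    simp only [coordPath, PiLp.add_apply, PiLp.smul_apply, PiLp.zero_apply, lt_irrefl, if_false,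
      sub_zero, PiLp.single_apply, if_true, smul_eq_mul, mul_one, zero_add, norm_mul]
    rw [Real.norm_of_nonneg hs.1]
    exact mul_le_of_le_one_left (norm_nonneg _) hs.2
  · simp only [coordPath, PiLp.add_apply, PiLp.smul_apply, PiLp.zero_apply,
      PiLp.single_apply, h, if_false, smul_zero, add_zero]
    split_ifs <;> simp

variable {K : Pt d → ℝ} {lam : ℕ}

/-- Taylor bounds for all partial derivatives. -/
theorem KernelFlat.exists_iterPartial_le (hK : KernelFlat K lam) (k : ℕ) :
    k ≤ lam → ∀ l : List (Fin d), l.length + k = lam + 1 →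
      ∃ M : ℝ, 0 ≤ M ∧ ∀ x, |iterPartial K l x| ≤ M * ‖x‖ ^ k := by
  -- Here `k` is the distance of the order from `lam + 1`. The top order is bounded; each lower
  -- order vanishes at the origin and gains a power of `‖x‖` by integrating the previous bound.
  induction k with
  | zero =>
    intro _ l hl
    obtain ⟨M, hM⟩ := hK.bounded l (by omega)
    exact ⟨M, (abs_nonneg _).trans (hM 0), fun x => by simpa using hM x⟩
  | succ k ih =>
    intro hk l hl
    have h1 : ∀ i : Fin d, ∃ M : ℝ, 0 ≤ M ∧ ∀ x, |iterPartial K (i :: l) x| ≤ M * ‖x‖ ^ k :=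
      fun i => ih (by omega) (i :: l) (by simp; omega)
    choose M hM0 hM using h1
    have hS0 : 0 ≤ ∑ i, M i := Finset.sum_nonneg fun i _ => hM0 i
    refine ⟨d * ∑ i, M i, by positivity, fun x => ?_⟩
    have h2 := abs_sub_le_of_partial_le (g := iterPartial K l) (M := (∑ i, M i) * ‖x‖ ^ k) x 0
      (fun i z => hK.exists_partial l (by omega) i z) (fun i s hs => by
        refine (hM i _).trans ?_
        gcongr
        · exact Finset.single_le_sum (fun i _ => hM0 i) (Finset.mem_univ i)
        · exact norm_coordPath_zero_le x i hs)
    rw [hK.vanish l (by omega) (by omega)] at h2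
    simp only [sub_zero] at h2
    refine h2.trans_eq ?_
    ring

/-- The last step of the same descent, kept apart because the kernel itself does not have to vanish
at the origin. -/
theorem KernelFlat.exists_abs_sub_le_pow (hK : KernelFlat K lam) :
    ∃ M : ℝ, 0 ≤ M ∧ ∀ x, |K x - K 0| ≤ M * ‖x‖ ^ (lam + 1) := by
  have h1 : ∀ i : Fin d, ∃ M : ℝ, 0 ≤ M ∧ ∀ x, |iterPartial K [i] x| ≤ M * ‖x‖ ^ lam :=
    fun i => hK.exists_iterPartial_le lam le_rfl [i] (by simp; omega)
  choose M hM0 hM using h1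
  have hS0 : 0 ≤ ∑ i, M i := Finset.sum_nonneg fun i _ => hM0 i
  refine ⟨d * ∑ i, M i, by positivity, fun x => ?_⟩
  have h2 := abs_sub_le_of_partial_le (g := K) (M := (∑ i, M i) * ‖x‖ ^ lam) x 0
    (fun i z => hK.exists_partial [] (by simp) i z) (fun i s hs => by
      refine (hM i _).trans ?_
      gcongr
      · exact Finset.single_le_sum (fun i _ => hM0 i) (Finset.mem_univ i)
      · exact norm_coordPath_zero_le x i hs)
  simp only [sub_zero] at h2
  refine h2.trans_eq ?_
  ring

theorem KernelAssumption.abs_le_one (hK : KernelAssumption K) (x : Pt d) : |K x| ≤ 1 := by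
  rw [abs_of_nonneg (hK.nonneg x)]
  exact hK.le_one x

/-- The kernel approximates its value at the origin to order `β`. -/
theorem KernelFlat.exists_abs_sub_one_le_rpow (hK : KernelAssumption K) (hflat : KernelFlat K lam)
    {β : ℝ} (hβ : 0 < β) (hlamβ : β - 1 < lam) :
    ∃ M : ℝ, 0 ≤ M ∧ ∀ x, |K x - 1| ≤ M * ‖x‖ ^ β := by
  obtain ⟨M, hM0, hM⟩ := hflat.exists_abs_sub_le_pow
  refine ⟨M + 1, by positivity, fun x => ?_⟩
  -- In the unit ball the exponent `lam + 1 > β` only helps; outside it `|K x - 1| ≤ 1 ≤ ‖x‖ ^ β`.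
  rcases le_total ‖x‖ 1 with h | h
  · have h1 := hM x
    rw [hK.at_zero] at h1
    refine h1.trans ?_
    have h2 : ‖x‖ ^ (lam + 1) ≤ ‖x‖ ^ β := by
      rw [← Real.rpow_natCast]
      rcases eq_or_lt_of_le (norm_nonneg x) with h0 | h0
      · rw [← h0, Real.zero_rpow hβ.ne', Real.zero_rpow (by positivity)]
      · exact Real.rpow_le_rpow_of_exponent_ge h0 h (by push_cast; linarith)
    have := Real.rpow_nonneg (norm_nonneg x) β
    nlinarith
  · have h1 : |K x - 1| ≤ 1 := by
      rw [abs_le]; constructor <;> linarith [hK.nonneg x, hK.le_one x]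
    have h2 : 1 ≤ ‖x‖ ^ β := Real.one_le_rpow h hβ.le
    nlinarith

theorem KernelAssumption.exists_radius (hK : KernelAssumption K) :
    ∃ R : ℝ, 1 ≤ R ∧ ∀ x, K x ≠ 0 → ‖x‖ ≤ R := by
  obtain ⟨R, hR⟩ := hK.bounded_support.exists_norm_le
  refine ⟨max R 1, le_max_right _ _, fun x hx => (hR x ?_).trans (le_max_left _ _)⟩
  exact lt_of_le_of_ne (hK.nonneg x) hx.symm

/-- First partial derivatives are bounded on the ball of radius `R` by the Taylor bound, and vanish
outside it, where the kernel is locally zero. -/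
theorem KernelFlat.exists_lipschitz (hK : KernelAssumption K) (hflat : KernelFlat K lam) :
    ∃ M : ℝ, 0 ≤ M ∧ ∀ x y, |K x - K y| ≤ M * ‖x - y‖ := by
  obtain ⟨R, hR1, hR⟩ := hK.exists_radius
  have h1 : ∀ i : Fin d, ∃ M : ℝ, 0 ≤ M ∧ ∀ x, |iterPartial K [i] x| ≤ M := by
    intro i
    obtain ⟨M, hM0, hM⟩ := hflat.exists_iterPartial_le lam le_rfl [i] (by simp; omega)
    refine ⟨M * R ^ lam, by positivity, fun x => ?_⟩
    rcases le_or_gt ‖x‖ R with h | h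
    · exact (hM x).trans (by gcongr)
    · have h0 : iterPartial K [i] x = 0 := by
        have hev : K =ᶠ[𝓝 x] fun _ => 0 := by
          filter_upwards [(isOpen_lt continuous_const continuous_norm).mem_nhds h] with y hy
          by_contra hne
          exact absurd (hR y hne) (not_le.2 hy)
        change lineDeriv ℝ K x _ = 0
        rw [hev.lineDeriv_eq]
        simp [lineDeriv]
      rw [h0, abs_zero]
      positivity
  choose M hM0 hM using h1
  have hS0 : 0 ≤ ∑ i, M i := Finset.sum_nonneg fun i _ => hM0 i
  refine ⟨d * ∑ i, M i, by positivity, fun x y => ?_⟩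
  have h2 := abs_sub_le_of_partial_le (g := K) (M := ∑ i, M i) x y
    (fun i z => hflat.exists_partial [] (by simp) i z) (fun i s _ => (hM i _).trans
      (Finset.single_le_sum (fun i _ => hM0 i) (Finset.mem_univ i)))
  refine h2.trans_eq ?_
  ring

end PartialDerivatives

/-! ### The covariance function is determined by its spectral density. -/

section FourierUniqueness

open FourierTransform in
/-- An integrable function with values in a Banach space is determined by its Fourier transform. -/
theorem ae_eq_zero_of_fourier_eq_zero {d : ℕ} {E : Type*} [NormedAddCommGroup E] [NormedSpace ℂ E]
    [CompleteSpace E] {D : Pt d → E} (hD : Integrable D)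
    (h : ∀ θ : Pt d, ∫ x, Complex.exp (Complex.I * ((⟪x, θ⟫_ℝ : ℝ) : ℂ)) • D x = 0) :
    D =ᵐ[volume] 0 := by
  refine ae_eq_zero_of_integral_contDiff_smul_eq_zero hD.locallyIntegrable ?_
  intro g hg hgc
  have hgc' : HasCompactSupport fun x => ((g x : ℝ) : ℂ) := hgc.comp_left (g := Complex.ofReal) rfl
  -- A smooth test function is the Fourier transform of a Schwartz function; the transform is then
  -- moved onto `D`, where it vanishes.
  let φ : SchwartzMap (Pt d) ℂ := hgc'.toSchwartzMap (Complex.ofRealCLM.contDiff.comp hg)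
  have hφ : ∀ x, 𝓕 (𝓕⁻ φ : SchwartzMap (Pt d) ℂ) x = (g x : ℂ) := by
    intro x
    rw [fourier_fourierInv_eq φ]
    rfl
  have hF : ∀ ξ, 𝓕 D ξ = 0 := by
    intro ξ
    -- The frequency `-2π ξ` reconciles the kernel `e^{-2πi⟨x,ξ⟩}` with the kernel `e^{i⟨x,θ⟩}`.
    rw [Real.fourier_eq', ← h ((-2 * Real.pi) • ξ)]
    congr with x
    congr 2
    rw [inner_smul_right]
    ring
  have hflip : ∫ ξ, 𝓕 (𝓕⁻ φ : SchwartzMap (Pt d) ℂ) ξ • D ξ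
      = ∫ x, (𝓕⁻ φ : SchwartzMap (Pt d) ℂ) x • 𝓕 D x := by
    rw [SchwartzMap.fourier_coe]
    simpa using! (VectorFourier.integral_fourierIntegral_smul_eq_flip (L := innerₗ (Pt d))
      Real.continuous_fourierChar continuous_inner (𝓕⁻ φ : SchwartzMap (Pt d) ℂ).integrable hD)
  simp only [hF, hφ, smul_zero, integral_zero, Complex.coe_smul] at hflip
  exact hflip

theorem integrable_cexp_smul {d : ℕ} {E : Type*} [NormedAddCommGroup E] [NormedSpace ℂ E]
    {D : Pt d → E} (hD : Integrable D) (θ : Pt d) :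
    Integrable fun x => Complex.exp (Complex.I * ((⟪x, θ⟫_ℝ : ℝ) : ℂ)) • D x := by
  have hc : Continuous fun x : Pt d => Complex.exp (Complex.I * ((⟪x, θ⟫_ℝ : ℝ) : ℂ)) := by
    fun_prop
  refine hD.norm.mono' (hc.aestronglyMeasurable.smul hD.1) ?_
  filter_upwards with x
  rw [norm_smul, mul_comm Complex.I, Complex.norm_exp_ofReal_mul_I, one_mul]

variable {H : Type*} [NormedAddCommGroup H] [InnerProductSpace ℂ H] [CompleteSpace H]
  {ι : Type*} {d : ℕ}

/-- An integrable covariance function inherits the moment bound of any other representative of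
its spectral density. -/
theorem lintegral_rpow_mul_hsNorm_le {e : HilbertBasis ι ℂ H} {C : Pt d → H →L[ℂ] H}
    {β L : ℝ} (hC : Integrable C) (hf : fourierOp C ∈ powerLawClass e d β L) :
    ∫⁻ x, ENNReal.ofReal (‖x‖ ^ β) * hsNorm e (C x) ≤ ENNReal.ofReal L := by
  obtain ⟨C', hC'm, hC'L, hCC'⟩ := hf
  have hC' : Integrable C' := by
    refine integrable_of_lintegral_traceNorm (e := e) hC'm (lt_of_le_of_lt ?_
      (hC'L.trans_lt ENNReal.ofReal_lt_top))
    refine lintegral_mono fun x => le_mul_of_one_le_left' ?_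
    rw [ENNReal.one_le_ofReal]
    have := Real.rpow_nonneg (norm_nonneg x) β
    linarith
  -- The class only provides some integrable `C'` with the same transform; uniqueness carries its
  -- moment bound over to `C`.
  have hae : C =ᵐ[volume] C' := by
    have h0 : (C - C') =ᵐ[volume] 0 := by
      refine ae_eq_zero_of_fourier_eq_zero (hC.sub hC') fun θ => ?_
      have h1 := hCC' θ
      rw [fourierOp, fourierOp] at h1
      have h2 := smul_right_injective (H →L[ℂ] H)
        (r := ((((2 * Real.pi) ^ d)⁻¹ : ℝ) : ℂ)) (by
          have : (0 : ℝ) < ((2 * Real.pi) ^ d)⁻¹ := by positivity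
          exact_mod_cast this.ne') h1
      simp only [Pi.sub_apply, smul_sub]
      rw [integral_sub (integrable_cexp_smul hC θ) (integrable_cexp_smul hC' θ), h2, sub_self]
    filter_upwards [h0] with x hx
    exact sub_eq_zero.1 hx
  refine le_trans (lintegral_mono_ae ?_) hC'L
  filter_upwards [hae] with x hx
  rw [hx]
  refine mul_le_mul' (ENNReal.ofReal_le_ofReal (by linarith)) (hsNorm_le_traceNorm e _)

end FourierUniqueness

/-! ### Bias on a fixed grid. -/

section Bias

variable {d : ℕ}

/-- A mesh that is fine, and a sampling box that is large, in comparison with the bandwidth. -/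
structure FineMesh (R δ Δ a : ℝ) (N : Fin d → ℕ) (T : Set (Pt d)) : Prop where
  radius_ge : 1 ≤ R
  mesh_pos : 0 < δ
  mesh_le : δ ≤ 1
  mesh_lt : √d * δ < 1
  bandwidth_ge : 1 ≤ Δ
  offset_nonneg : 0 ≤ a
  offset_le : a ≤ δ
  region_eq : T = closedBox (fun _ => a) fun l => N l * δ
  side_ge : ∀ l, 2 * (R * Δ + 1) ≤ N l * δ - a

/-- The volume of the overlap of the region with its translate by `-h`. -/
noncomputable def overlap (T : Set (Pt d)) (h : Pt d) : ℝ := volume.real (T ∩ (fun x => x - h) '' T)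

/-- The edge correction: the scaled number of lattice pairs at lag `m` over the overlap volume. -/
noncomputable def edgeRatio (δ : ℝ) (N : Fin d → ℕ) (T : Set (Pt d)) (m : Fin d → ℤ) : ℝ :=
  δ ^ d * ((∏ l, ((N l : ℤ) - |m l|).toNat : ℕ) : ℝ) / overlap T (latticePt δ m)

theorem one_add_pow_le {δ : ℝ} (h0 : 0 ≤ δ) (h1 : δ ≤ 1) (n : ℕ) :
    (1 + δ) ^ n ≤ 1 + (2 ^ n - 1) * δ := by
  induction n with
  | zero => simp
  | succ n ih =>
    have h2 : (1 : ℝ) ≤ 2 ^ n := one_le_pow₀ (by norm_num)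
    rw [pow_succ, pow_succ]
    nlinarith [mul_nonneg (mul_nonneg (sub_nonneg.2 h2) h0) (sub_nonneg.2 h1)]

namespace FineMesh

variable {R δ Δ a : ℝ} {N : Fin d → ℕ} {T : Set (Pt d)}

theorem abs_apply_le {R Δ : ℝ} {h : Pt d} (hh : ‖h‖ ≤ R * Δ) (l : Fin d) :
    |h l| ≤ R * Δ := by
  have := PiLp.norm_apply_le h l
  rw [Real.norm_eq_abs] at this
  exact this.trans hh

theorem overlap_eq (hM : FineMesh R δ Δ a N T) {h : Pt d} (hh : ‖h‖ ≤ R * Δ) :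
    overlap T h = ∏ l, (N l * δ - a - |h l|) := by
  have hRΔ : 0 ≤ R * Δ := (norm_nonneg h).trans hh
  rw [overlap, hM.region_eq, volume_real_closedBox_inter_shift]
  intro l
  have := hM.side_ge l; have := abs_apply_le hh l
  linarith

theorem volume_eq (hM : FineMesh R δ Δ a N T) : volume.real T = ∏ l, (N l * δ - a) := by
  have hR := hM.radius_ge; have hΔ := hM.bandwidth_ge
  rw [hM.region_eq, volume_real_closedBox]
  intro l
  have := hM.side_ge l
  nlinarith

theorem volume_pos (hM : FineMesh R δ Δ a N T) : 0 < volume.real T := by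
  have hR := hM.radius_ge; have hΔ := hM.bandwidth_ge
  rw [hM.volume_eq]
  refine Finset.prod_pos fun l _ => ?_
  have := hM.side_ge l
  nlinarith

/-- The shift removes at most `RΔ` from each side, which is at most half of it by `side_ge`. -/
theorem le_overlap (hM : FineMesh R δ Δ a N T) {h : Pt d} (hh : ‖h‖ ≤ R * Δ) :
    volume.real T / 2 ^ d ≤ overlap T h := by
  have hRΔ : 0 ≤ R * Δ := (norm_nonneg h).trans hh
  have h2 : (2 : ℝ) ^ d = ∏ _l : Fin d, (2 : ℝ) := by simp
  rw [hM.overlap_eq hh, hM.volume_eq, h2, ← Finset.prod_div_distrib]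
  refine Finset.prod_le_prod (fun l _ => ?_) fun l _ => ?_ <;>
  · have := hM.side_ge l; have := abs_apply_le hh l
    linarith

/-- In each coordinate the ratio is `1 + a / (N l * δ - a - |h l|)`, where `h` is the lag, the
numerator is at most `δ` and the denominator at least `1`. For the box, `a = 0` and there is no edge
error. -/
theorem edgeRatio_mem (hM : FineMesh R δ Δ a N T) {m : Fin d → ℤ}
    (hm : ‖latticePt δ m‖ ≤ R * Δ) : edgeRatio δ N T m ∈ Set.Icc 1 (1 + 2 ^ d * δ) := by
  have hδ := hM.mesh_pos
  have hm' : ∀ l, |latticePt δ m l| = |(m l : ℝ)| * δ := fun l => by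
    rw [latticePt_apply, abs_mul, abs_of_pos hδ]
  have hu : ∀ l, 1 ≤ N l * δ - a - |latticePt δ m l| := by
    intro l
    have h1 := hM.side_ge l; have h2 := abs_apply_le hm l
    have h3 := abs_nonneg (latticePt δ m l)
    linarith
  have hcast : ∀ l, ((((N l : ℤ) - |m l|).toNat : ℕ) : ℝ) = N l - |(m l : ℝ)| := by
    intro l
    have h1 := hu l
    rw [hm'] at h1
    have h2 : |(m l : ℝ)| ≤ N l := by
      have h3 : 0 < (N l - |(m l : ℝ)|) * δ := by linarith [hM.offset_nonneg]
      linarith [pos_of_mul_pos_left h3 hδ.le]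
    have h4 : |m l| ≤ (N l : ℤ) := by exact_mod_cast h2
    have h5 : ((((N l : ℤ) - |m l|).toNat : ℕ) : ℤ) = N l - |m l| :=
      Int.toNat_of_nonneg (by linarith)
    rw [← Int.cast_natCast, h5]
    push_cast
    rfl
  have heq : edgeRatio δ N T m
      = ∏ l, (1 + a / (N l * δ - a - |latticePt δ m l|)) := by
    have h2 : δ ^ d = ∏ _l : Fin d, δ := by simp
    rw [edgeRatio, hM.overlap_eq hm, h2, Nat.cast_prod, ← Finset.prod_mul_distrib,
      ← Finset.prod_div_distrib]
    refine Finset.prod_congr rfl fun l _ => ?_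
    have h1 := hu l
    rw [hcast, eq_comm, one_add_div (by linarith), hm']
    congr 1
    ring
  rw [heq]
  have hfac : ∀ l, 0 ≤ a / (N l * δ - a - |latticePt δ m l|) ∧
      a / (N l * δ - a - |latticePt δ m l|) ≤ δ := by
    intro l
    refine ⟨div_nonneg hM.offset_nonneg (by linarith [hu l]), ?_⟩
    exact (div_le_self hM.offset_nonneg (hu l)).trans hM.offset_le
  constructor
  · calc (1 : ℝ) = ∏ _l : Fin d, 1 := by simp
      _ ≤ _ := Finset.prod_le_prod (fun _ _ => zero_le_one) fun l _ => by linarith [(hfac l).1]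
  · calc _ ≤ ∏ _l : Fin d, (1 + δ) :=
          Finset.prod_le_prod (fun l _ => by linarith [(hfac l).1]) fun l _ => by
            linarith [(hfac l).2]
      _ = (1 + δ) ^ d := by simp
      _ ≤ 1 + (2 ^ d - 1) * δ := one_add_pow_le hδ.le hM.mesh_le d
      _ ≤ _ := by nlinarith

end FineMesh

/-- Gives the step function finite support, so its integral is a finite lattice sum. -/
theorem edgeRatio_eq_zero {δ : ℝ} {N : Fin d → ℕ} {T : Set (Pt d)} {m : Fin d → ℤ}
    (hm : m ∉ Fintype.piFinset fun l => Finset.Icc (-(N l : ℤ)) (N l)) :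
    edgeRatio δ N T m = 0 := by
  simp only [Fintype.mem_piFinset, Finset.mem_Icc, not_forall] at hm
  obtain ⟨l, hl⟩ := hm
  have h : ((N l : ℤ) - |m l|).toNat = 0 := by
    rw [Int.toNat_eq_zero]
    by_contra hc
    exact hl (abs_le.1 (by linarith [not_le.1 hc]))
  rw [edgeRatio, Finset.prod_eq_zero (Finset.mem_univ l) h]
  simp

section Estimator

variable {H : Type*} [NormedAddCommGroup H] [InnerProductSpace ℂ H] [CompleteSpace H]
  {ι Ω : Type*} [MeasurableSpace Ω] {P : Measure Ω} {e : HilbertBasis ι ℂ H}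
  {X : Pt d → Ω → H} {K : Pt d → ℝ}

open InnerProductSpace (rankOne)

/-- The character `x ↦ e^{i xᵀθ}`. -/
noncomputable def chi (θ x : Pt d) : ℂ := Complex.exp (Complex.I * ((⟪x, θ⟫_ℝ : ℝ) : ℂ))

theorem norm_chi (θ x : Pt d) : ‖chi θ x‖ = 1 := by
  rw [chi, mul_comm, Complex.norm_exp_ofReal_mul_I]

theorem norm_chi_sub_le (θ x y : Pt d) : ‖chi θ x - chi θ y‖ ≤ ‖x - y‖ * ‖θ‖ := by
  have h : chi θ x - chi θ y
      = chi θ y * (Complex.exp (Complex.I * ((⟪x - y, θ⟫_ℝ : ℝ) : ℂ)) - 1) := by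
    rw [mul_sub, mul_one, chi, chi, ← Complex.exp_add, inner_sub_left]
    push_cast
    ring_nf
  rw [h, norm_mul, norm_chi, one_mul]
  exact (Real.norm_exp_I_mul_ofReal_sub_one_le).trans (abs_real_inner_le_norm _ _)

/-- The weight of a pair of observations at lag `h`. -/
noncomputable def pairWeight (K : Pt d → ℝ) (δ : ℝ) (T : Set (Pt d)) (Δ : ℝ) (θ h : Pt d) : ℂ :=
  ((δ ^ (2 * d) / (2 * Real.pi) ^ d : ℝ) : ℂ) *
    (chi θ h * ((K (Δ⁻¹ • h) / overlap T h : ℝ) : ℂ))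

omit [CompleteSpace H] [MeasurableSpace Ω] in
theorem specEstimator_eq_sum {δ : ℝ} (hδ : 0 < δ) (N : Fin d → ℕ) (T : Set (Pt d)) (Δ : ℝ)
    (θ : Pt d) (ω : Ω) :
    specEstimator K X δ N T Δ θ ω
      = ∑ p ∈ gridIdx N ×ˢ gridIdx N, pairWeight K δ T Δ θ (latticePt δ (p.1 - p.2)) •
          rankOne ℂ (X (latticePt δ p.1) ω) (X (latticePt δ p.2) ω) := by
  rw [specEstimator, sum_gridPoints hδ, Finset.sum_product, Finset.smul_sum]
  refine Finset.sum_congr rfl fun k _ => ?_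
  rw [sum_gridPoints hδ, Finset.smul_sum]
  refine Finset.sum_congr rfl fun k' _ => ?_
  rw [smul_smul, latticePt_sub]
  rfl

theorem IsStationaryRealProcess.integral_specEstimator (hX : IsStationaryRealProcess e P X)
    {δ : ℝ} (hδ : 0 < δ) (N : Fin d → ℕ) (T : Set (Pt d)) (Δ : ℝ) (θ : Pt d) :
    ∫ ω, specEstimator K X δ N T Δ θ ω ∂P
      = ∑ p ∈ gridIdx N ×ˢ gridIdx N, pairWeight K δ T Δ θ (latticePt δ (p.1 - p.2)) •
          crossCov P (X (latticePt δ p.1)) (X (latticePt δ p.2)) := by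
  simp_rw [specEstimator_eq_sum hδ]
  have hint : ∀ p ∈ gridIdx N ×ˢ gridIdx N, Integrable (fun ω =>
      pairWeight K δ T Δ θ (latticePt δ (p.1 - p.2)) •
        rankOne ℂ (X (latticePt δ p.1) ω) (X (latticePt δ p.2) ω)) P := fun p _ => by
    have h := integrable_rankOne (hX.memLp_two (latticePt δ p.1)) (hX.memLp_two (latticePt δ p.2))
    exact h.smul (pairWeight K δ T Δ θ (latticePt δ (p.1 - p.2)))
  rw [integral_finsetSum _ hint]
  refine Finset.sum_congr rfl fun p _ => ?_
  rw [integral_smul]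
  rfl

/-- The expectation of the estimator as the integral of a step function. -/
theorem IsStationaryRealProcess.integral_specEstimator_eq_integral
    (hX : IsStationaryRealProcess e P X)
    {δ : ℝ} (hδ : 0 < δ) (N : Fin d → ℕ) (T : Set (Pt d)) (Δ : ℝ) (θ : Pt d) :
    ∫ ω, specEstimator K X δ N T Δ θ ω ∂P
      = ((((2 * Real.pi) ^ d)⁻¹ : ℝ) : ℂ) • ∫ x : Pt d,
        (fun m => ((edgeRatio δ N T m * K (Δ⁻¹ • latticePt δ m) : ℝ) * chi θ (latticePt δ m)) •
          covOp P X (latticePt δ m)) (cellIdx δ x) := by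
  rw [hX.integral_specEstimator hδ, integral_comp_cellIdx (F := fun m =>
    ((edgeRatio δ N T m * K (Δ⁻¹ • latticePt δ m) : ℝ) * chi θ (latticePt δ m)) •
      covOp P X (latticePt δ m)) hδ (Fintype.piFinset fun l => Finset.Icc (-(N l : ℤ)) (N l))
    fun m hm => by simp [edgeRatio_eq_zero hm], Finset.sum_product]
  simp_rw [hX.crossCov_eq, ← latticePt_sub]
  -- After grouping by lag, the factor `δ^{2d}` splits into one `δ^d` inside `edgeRatio` and one for
  -- the cell volume.
  rw [sum_sum_gridIdx_sub N fun m =>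
    pairWeight K δ T Δ θ (latticePt δ m) • covOp P X (latticePt δ m), Finset.smul_sum,
    Finset.smul_sum]
  refine Finset.sum_congr rfl fun m _ => ?_
  rw [← Nat.cast_smul_eq_nsmul ℂ, ← Complex.coe_smul (δ ^ d), smul_smul, smul_smul, smul_smul]
  congr 1
  rw [pairWeight, edgeRatio]
  push_cast
  ring

/-- The bias of the estimator on a fixed grid. -/
theorem FineMesh.hsNorm_bias_le [Countable ι] {R δ Δ a : ℝ} {N : Fin d → ℕ} {T : Set (Pt d)}
    (hM : FineMesh R δ Δ a N T) (hX : IsStationaryRealProcess e P X)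
    (hC : Integrable (covOp P X)) (hK : KernelAssumption K) (hR : ∀ x, K x ≠ 0 → ‖x‖ ≤ R)
    {A B β : ℝ} (hA0 : 0 ≤ A) (hA : ∀ x y, |K x - K y| ≤ A * ‖x - y‖)
    (hB0 : 0 ≤ B) (hB : ∀ x, |K x - 1| ≤ B * ‖x‖ ^ β)
    {θ : Pt d} {r : ℝ} (hθ : ‖θ‖ ≤ r) :
    hsNorm e ((∫ ω, specEstimator K X δ N T Δ θ ω ∂P) - spectralDensity P X θ)
      ≤ ENNReal.ofReal (1 + 2 ^ d) * (∫⁻ x, hsNorm e (covOp P X (latticePt δ (cellIdx δ x))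
            - covOp P X x))
        + (ENNReal.ofReal ((2 ^ d + √d * r + A * √d) * δ) * (∫⁻ x, hsNorm e (covOp P X x))
        + ENNReal.ofReal (B * Δ ^ (-β)) *
            ∫⁻ x, ENNReal.ofReal (‖x‖ ^ β) * hsNorm e (covOp P X x)) := by
  have hδ := hM.mesh_pos
  have hΔ : 0 < Δ := by linarith [hM.bandwidth_ge]
  set C := covOp P X with hCdef
  set s : (Fin d → ℤ) → ℂ := fun m =>
    (edgeRatio δ N T m * K (Δ⁻¹ • latticePt δ m) : ℝ) * chi θ (latticePt δ m) with hs
  -- Lags outside the support contribute `0` because of the kernel factor, so the edge ratio is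
  -- controlled only where `edgeRatio_mem` applies.
  have hratio : ∀ m, |(edgeRatio δ N T m - 1) * K (Δ⁻¹ • latticePt δ m)| ≤ 2 ^ d * δ := by
    intro m
    by_cases h0 : K (Δ⁻¹ • latticePt δ m) = 0
    · rw [h0, mul_zero, abs_zero]; positivity
    · have h1 := hR _ h0
      rw [norm_smul, Real.norm_of_nonneg (by positivity), inv_mul_le_iff₀ hΔ, mul_comm] at h1
      have h2 := hM.edgeRatio_mem h1
      rw [abs_mul]
      have h3 : |edgeRatio δ N T m - 1| ≤ 2 ^ d * δ := by
        rw [abs_le]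
        constructor
        · have : 0 ≤ 2 ^ d * δ := by positivity
          linarith [h2.1]
        · linarith [h2.2]
      exact (mul_le_mul h3 (hK.abs_le_one _) (abs_nonneg _) (by positivity)).trans_eq (mul_one _)
  have hsnorm : ∀ m, ‖s m‖ ≤ 1 + 2 ^ d := by
    intro m
    rw [hs, norm_mul, norm_chi, mul_one, Complex.norm_real, Real.norm_eq_abs]
    have h1 : edgeRatio δ N T m * K (Δ⁻¹ • latticePt δ m)
        = (edgeRatio δ N T m - 1) * K (Δ⁻¹ • latticePt δ m) + K (Δ⁻¹ • latticePt δ m) := by ring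
    rw [h1]
    have h2 : (2 : ℝ) ^ d * δ ≤ 2 ^ d := mul_le_of_le_one_right (by positivity) hM.mesh_le
    refine (abs_add_le _ _).trans ?_
    linarith [hratio m, hK.abs_le_one (Δ⁻¹ • latticePt δ m)]
  have hdiff : ∀ x, ‖s (cellIdx δ x) - chi θ x‖
      ≤ (2 ^ d + √d * r + A * √d) * δ + B * Δ ^ (-β) * ‖x‖ ^ β := by
    intro x
    set g := latticePt δ (cellIdx δ x) with hg
    have hgx : ‖g - x‖ ≤ √d * δ := norm_latticePt_cellIdx_sub_le hδ x
    -- Four errors: edge correction, character at the corner, kernel at the corner, and the kernel's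
    -- distance from `1`. Only the last is not of order `δ`.
    have h1 : s (cellIdx δ x) - chi θ x
        = ((((edgeRatio δ N T (cellIdx δ x) - 1) * K (Δ⁻¹ • g) : ℝ) : ℂ) * chi θ g
          + ((K (Δ⁻¹ • g) : ℝ) : ℂ) * (chi θ g - chi θ x))
          + (((K (Δ⁻¹ • g) - K (Δ⁻¹ • x) : ℝ) : ℂ) * chi θ x
          + ((K (Δ⁻¹ • x) - 1 : ℝ) : ℂ) * chi θ x) := by
      rw [hs]; push_cast; ring
    have n1 : ‖(((edgeRatio δ N T (cellIdx δ x) - 1) * K (Δ⁻¹ • g) : ℝ) : ℂ) * chi θ g‖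
        ≤ 2 ^ d * δ := by
      rw [norm_mul, norm_chi, mul_one, Complex.norm_real]; exact hratio _
    have n2 : ‖((K (Δ⁻¹ • g) : ℝ) : ℂ) * (chi θ g - chi θ x)‖ ≤ √d * r * δ := by
      rw [norm_mul, Complex.norm_real, Real.norm_eq_abs]
      calc _ ≤ 1 * (‖g - x‖ * ‖θ‖) := by
            gcongr
            · exact hK.abs_le_one _
            · exact norm_chi_sub_le θ g x
        _ ≤ 1 * ((√d * δ) * r) := by gcongr
        _ = _ := by ring
    have n3 : ‖((K (Δ⁻¹ • g) - K (Δ⁻¹ • x) : ℝ) : ℂ) * chi θ x‖ ≤ A * √d * δ := by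
      rw [norm_mul, norm_chi, mul_one, Complex.norm_real, Real.norm_eq_abs]
      refine (hA _ _).trans ?_
      rw [← smul_sub, norm_smul, Real.norm_of_nonneg (by positivity), mul_assoc]
      refine mul_le_mul_of_nonneg_left ?_ hA0
      calc Δ⁻¹ * ‖g - x‖ ≤ 1 * ‖g - x‖ := by
            gcongr; exact inv_le_one_of_one_le₀ hM.bandwidth_ge
        _ ≤ _ := by rw [one_mul]; exact hgx
    have n4 : ‖((K (Δ⁻¹ • x) - 1 : ℝ) : ℂ) * chi θ x‖ ≤ B * Δ ^ (-β) * ‖x‖ ^ β := by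
      rw [norm_mul, norm_chi, mul_one, Complex.norm_real, Real.norm_eq_abs]
      refine (hB _).trans_eq ?_
      rw [norm_smul, Real.norm_of_nonneg (by positivity),
        Real.mul_rpow (by positivity) (norm_nonneg _), Real.inv_rpow hΔ.le, Real.rpow_neg hΔ.le,
        mul_assoc]
    rw [h1]
    have := norm_add_le_of_le (norm_add_le_of_le n1 n2) (norm_add_le_of_le n3 n4)
    linarith
  have hpt : ∀ x, hsNorm e (s (cellIdx δ x) • C (latticePt δ (cellIdx δ x)) - chi θ x • C x)
      ≤ ENNReal.ofReal (1 + 2 ^ d) * hsNorm e (C (latticePt δ (cellIdx δ x)) - C x)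
        + (ENNReal.ofReal ((2 ^ d + √d * r + A * √d) * δ) * hsNorm e (C x)
        + ENNReal.ofReal (B * Δ ^ (-β)) * (ENNReal.ofReal (‖x‖ ^ β) * hsNorm e (C x))) := by
    intro x
    -- The bounded weight multiplies the increment of `C`, and the weight error multiplies `C x`
    -- itself, which has the integrable moments.
    have h1 : s (cellIdx δ x) • C (latticePt δ (cellIdx δ x)) - chi θ x • C x
        = s (cellIdx δ x) • (C (latticePt δ (cellIdx δ x)) - C x)
          + (s (cellIdx δ x) - chi θ x) • C x := by
      rw [smul_sub, sub_smul]; abel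
    rw [h1]
    refine (hsNorm_add_le e _ _).trans ?_
    rw [hsNorm_smul, hsNorm_smul]
    refine add_le_add ?_ ?_
    · gcongr
      rw [← ofReal_norm]
      exact ENNReal.ofReal_le_ofReal (hsnorm _)
    · rw [← mul_assoc, ← add_mul]
      gcongr
      have hr0 : 0 ≤ r := (norm_nonneg θ).trans hθ
      have hxβ : 0 ≤ ‖x‖ ^ β := Real.rpow_nonneg (norm_nonneg x) β
      have hΔβ : 0 ≤ Δ ^ (-β) := Real.rpow_nonneg hΔ.le _
      rw [← ENNReal.ofReal_mul (by positivity), ← ENNReal.ofReal_add (by positivity)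
        (by positivity), ← ofReal_norm]
      exact ENNReal.ofReal_le_ofReal (hdiff x)
  have hint1 : Integrable fun x : Pt d =>
      (fun m => s m • C (latticePt δ m)) (cellIdx δ x) :=
    integrable_comp_cellIdx (F := fun m => s m • C (latticePt δ m)) hδ
      (Fintype.piFinset fun l => Finset.Icc (-(N l : ℤ)) (N l))
      fun m hm => by simp [hs, edgeRatio_eq_zero hm]
  have hint2 : Integrable fun x : Pt d => chi θ x • C x := integrable_cexp_smul hC θ
  have hpi : ‖((((2 * Real.pi) ^ d)⁻¹ : ℝ) : ℂ)‖ₑ ≤ 1 := by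
    rw [← ofReal_norm, ENNReal.ofReal_le_one, Complex.norm_real,
      Real.norm_of_nonneg (by positivity)]
    refine inv_le_one_of_one_le₀ (one_le_pow₀ ?_)
    linarith [Real.pi_gt_three]
  rw [hX.integral_specEstimator_eq_integral hδ, spectralDensity, fourierOp, ← smul_sub,
    hsNorm_smul]
  refine (mul_le_of_le_one_left' hpi).trans ?_
  change hsNorm e ((∫ x : Pt d, (fun m => s m • C (latticePt δ m)) (cellIdx δ x))
    - ∫ x : Pt d, chi θ x • C x) ≤ _
  rw [← integral_sub hint1 hint2]
  refine (hsNorm_integral_le e _).trans ((lintegral_mono hpt).trans_eq ?_)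
  have hm1 : AEMeasurable (fun x => hsNorm e (C x)) volume := aemeasurable_hsNorm e hC.1
  have hm2 : AEMeasurable (fun x : Pt d => ENNReal.ofReal (‖x‖ ^ β)) volume := by fun_prop
  have hm3 : AEMeasurable (fun x : Pt d => ENNReal.ofReal (B * Δ ^ (-β)) *
      (ENNReal.ofReal (‖x‖ ^ β) * hsNorm e (C x))) volume := (hm2.mul hm1).const_mul _
  have hm4 : AEMeasurable (fun x : Pt d =>
      ENNReal.ofReal ((2 ^ d + √d * r + A * √d) * δ) * hsNorm e (C x)
        + ENNReal.ofReal (B * Δ ^ (-β)) * (ENNReal.ofReal (‖x‖ ^ β) * hsNorm e (C x))) volume :=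
    (hm1.const_mul _).add hm3
  rw [lintegral_add_right' _ hm4, lintegral_add_right' _ hm3,
    lintegral_const_mul' _ _ ENNReal.ofReal_ne_top, lintegral_const_mul' _ _ ENNReal.ofReal_ne_top,
    lintegral_const_mul' _ _ ENNReal.ofReal_ne_top]

end Estimator

end Bias

/-! ### Variance on a fixed grid. -/

section Variance

variable {d : ℕ}

theorem sum_comp_sub_right_le_tsum {G : Type*} [AddGroup G] (B : Finset G) (F : G → ℝ≥0∞) (s : G) :
    ∑ t ∈ B, F (t - s) ≤ ∑' m, F m :=
  (ENNReal.sum_le_tsum B).trans_eq ((Equiv.subRight s).tsum_eq F)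

theorem sum_comp_sub_left_le_tsum {G : Type*} [AddGroup G] (B : Finset G) (F : G → ℝ≥0∞) (s : G) :
    ∑ t ∈ B, F (s - t) ≤ ∑' m, F m :=
  (ENNReal.sum_le_tsum B).trans_eq ((Equiv.subLeft s).tsum_eq F)

/-- Summation of the three parts of the covariance of two pairs of observations. -/
theorem sum_sum_pairs_le {G : Type*} [AddGroup G] (B : Finset G) (b ρ : G → ℝ≥0∞)
    (hb : ∀ m, b m ≤ 1) (κ : G → G → G → ℝ≥0∞) {Γ : ℝ≥0∞}
    (hκ : ∀ w, ∑' u, ∑' v, κ u v w ≤ Γ) :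
    ∑ p ∈ B ×ˢ B, ∑ q ∈ B ×ˢ B, b (p.1 - p.2) * b (q.1 - q.2) *
        (κ (p.1 - q.2) (p.2 - q.2) (q.1 - q.2) + ρ (q.1 - p.1) * ρ (p.2 - q.2)
          + ρ (p.1 - q.2) * ρ (q.1 - p.2))
      ≤ (B.card : ℝ≥0∞) * (∑' m, b m) * (Γ + 2 * (∑' m, ρ m) ^ 2) := by
  have hbsum : ∑ p ∈ B ×ˢ B, b (p.1 - p.2) ≤ (B.card : ℝ≥0∞) * ∑' m, b m := by
    rw [Finset.sum_product]
    refine (Finset.sum_le_sum fun k _ => sum_comp_sub_left_le_tsum B b k).trans_eq ?_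
    rw [Finset.sum_const, nsmul_eq_mul]
  -- For the cumulant, `q` is fixed and both entries of `p` are summed; the indicator of `q` is the
  -- one retained. For the covariance products below the roles are reversed, and the sum over `q`
  -- factorises.
  have h1 : ∑ p ∈ B ×ˢ B, ∑ q ∈ B ×ˢ B, b (q.1 - q.2) * κ (p.1 - q.2) (p.2 - q.2) (q.1 - q.2)
      ≤ (B.card : ℝ≥0∞) * (∑' m, b m) * Γ := by
    rw [Finset.sum_comm]
    calc _ ≤ ∑ q ∈ B ×ˢ B, b (q.1 - q.2) * Γ := by
          refine Finset.sum_le_sum fun q _ => ?_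
          rw [← Finset.mul_sum, Finset.sum_product]
          gcongr
          refine le_trans ?_ (hκ (q.1 - q.2))
          refine (Finset.sum_le_sum fun k _ => sum_comp_sub_right_le_tsum B
            (fun v => κ (k - q.2) v (q.1 - q.2)) q.2).trans ?_
          exact sum_comp_sub_right_le_tsum B (fun u => ∑' v, κ u v (q.1 - q.2)) q.2
      _ ≤ _ := by rw [← Finset.sum_mul]; gcongr
  have h2 : ∀ f g : G × G → G, (∀ p : G × G, ∑ q ∈ B ×ˢ B, ρ (q.1 - f p) * ρ (g p - q.2)
      ≤ (∑' m, ρ m) ^ 2) := by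
    intro f g p
    rw [Finset.sum_product, ← Finset.sum_mul_sum B B (fun k => ρ (k - f p))
      (fun k => ρ (g p - k)), sq]
    exact mul_le_mul' (sum_comp_sub_right_le_tsum B ρ _) (sum_comp_sub_left_le_tsum B ρ _)
  have h3 : ∀ f g : G × G → G, ∑ p ∈ B ×ˢ B, ∑ q ∈ B ×ˢ B,
      b (p.1 - p.2) * (ρ (q.1 - f p) * ρ (g p - q.2))
      ≤ (B.card : ℝ≥0∞) * (∑' m, b m) * (∑' m, ρ m) ^ 2 := by
    intro f g
    calc _ ≤ ∑ p ∈ B ×ˢ B, b (p.1 - p.2) * (∑' m, ρ m) ^ 2 := by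
          refine Finset.sum_le_sum fun p _ => ?_
          rw [← Finset.mul_sum]
          gcongr
          exact h2 f g p
      _ ≤ _ := by rw [← Finset.sum_mul]; gcongr
  calc _ ≤ ∑ p ∈ B ×ˢ B, ∑ q ∈ B ×ˢ B,
        (b (q.1 - q.2) * κ (p.1 - q.2) (p.2 - q.2) (q.1 - q.2)
          + b (p.1 - p.2) * (ρ (q.1 - p.1) * ρ (p.2 - q.2))
          + b (p.1 - p.2) * (ρ (q.1 - p.2) * ρ (p.1 - q.2))) := by
        refine Finset.sum_le_sum fun p _ => Finset.sum_le_sum fun q _ => ?_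
        rw [mul_add, mul_add]
        refine add_le_add (add_le_add ?_ ?_) ?_
        · gcongr
          exact mul_le_of_le_one_left' (hb _)
        · gcongr
          exact mul_le_of_le_one_right' (hb _)
        · rw [mul_comm (ρ (p.1 - q.2))]
          gcongr
          exact mul_le_of_le_one_right' (hb _)
    _ ≤ (B.card : ℝ≥0∞) * (∑' m, b m) * Γ + (B.card : ℝ≥0∞) * (∑' m, b m) * (∑' m, ρ m) ^ 2
        + (B.card : ℝ≥0∞) * (∑' m, b m) * (∑' m, ρ m) ^ 2 := by
        simp_rw [Finset.sum_add_distrib]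
        exact add_le_add (add_le_add h1 (h3 Prod.fst Prod.snd)) (h3 Prod.snd Prod.fst)
    _ = _ := by ring

open Classical in
/-- The indicator of lags within the support of the kernel. -/
noncomputable def lagIndicator (δ r : ℝ) (m : Fin d → ℤ) : ℝ≥0∞ :=
  if ‖latticePt δ m‖ ≤ r then 1 else 0

theorem lagIndicator_le_one (δ r : ℝ) (m : Fin d → ℤ) : lagIndicator δ r m ≤ 1 := by
  rw [lagIndicator]; split_ifs <;> simp

/-- The cardinality of the lattice points in a ball. -/
theorem tsum_lagIndicator_le {δ r r' : ℝ} (hδ : 0 < δ) (hr : r + √d * δ ≤ r') (hr' : 0 ≤ r') :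
    ENNReal.ofReal (δ ^ d) * ∑' m : Fin d → ℤ, lagIndicator δ r m
      ≤ ENNReal.ofReal (r' ^ d) * volume (Metric.closedBall (0 : Pt d) 1) := by
  rw [← lintegral_comp_cellIdx hδ]
  calc _ ≤ ∫⁻ x : Pt d, (Metric.closedBall (0 : Pt d) r').indicator 1 x := by
        refine lintegral_mono fun x => ?_
        rw [lagIndicator]
        split_ifs with h
        · rw [Set.indicator_of_mem]
          · rfl
          · rw [mem_closedBall_zero_iff]
            have h1 := norm_latticePt_cellIdx_sub_le hδ x
            have h2 := norm_sub_le (latticePt δ (cellIdx δ x)) (latticePt δ (cellIdx δ x) - x)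
            rw [sub_sub_cancel] at h2
            linarith
        · exact zero_le
    _ = volume (Metric.closedBall (0 : Pt d) r') := lintegral_indicator_one measurableSet_closedBall
    _ = _ := by
        rw [Measure.addHaar_closedBall' _ _ hr', finrank_euclideanSpace_fin]

variable {H : Type*} [NormedAddCommGroup H] [InnerProductSpace ℂ H] [CompleteSpace H]
  {ι Ω : Type*} [MeasurableSpace Ω] {P : Measure Ω} {e : HilbertBasis ι ℂ H}
  {X : Pt d → Ω → H} {K : Pt d → ℝ}

open InnerProductSpace (rankOne)

/-- The lattice sum is the integral of the corner values, which exceed the values of the integrand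
by at most twice the trace norm increment over the cell. -/
theorem tsum_covSize_le [Countable ι] {δ : ℝ} (hδ : 0 < δ)
    (hC : AEStronglyMeasurable (covOp P X) volume) :
    ENNReal.ofReal (δ ^ d) * ∑' m : Fin d → ℤ, covSize e P X (latticePt δ m)
      ≤ (∫⁻ x, covSize e P X x) + 2 * ∫⁻ x, traceNorm e (covOp P X (latticePt δ (cellIdx δ x))
        - covOp P X x) := by
  rw [← lintegral_comp_cellIdx hδ (fun m => covSize e P X (latticePt δ m)),
    ← lintegral_const_mul' _ _ (by simp), ← lintegral_add_left' (aemeasurable_covSize hC)]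
  exact lintegral_mono fun x => covSize_le_add e x _

/-- Each cell corner is within `√d * δ < ε` of every point of the cell, so the corner value is one
of those in the local supremum. The third shift is taken to be `0`. -/
theorem tsum_tsum_cum4_le {δ ε : ℝ} (hδ : 0 < δ) (hε : √d * δ < ε) (w : Pt d) :
    ∑' u : Fin d → ℤ, ∑' v : Fin d → ℤ, ENNReal.ofReal (δ ^ d) ^ 2 *
        ‖cum4 e P (X (latticePt δ u)) (X (latticePt δ v)) (X w) (X 0)‖ₑ
      ≤ ⨆ w : Pt d, ∫⁻ u : Pt d, ∫⁻ v : Pt d,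
      ⨆ l₁ ∈ Metric.ball (0 : Pt d) ε, ⨆ l₂ ∈ Metric.ball (0 : Pt d) ε,
        ⨆ l₃ ∈ Metric.ball (0 : Pt d) ε,
          ‖cum4 e P (X (l₁ + u)) (X (l₂ + v)) (X (l₃ + w)) (X 0)‖ₑ := by
  refine le_trans ?_ (le_iSup (fun w : Pt d => ∫⁻ u : Pt d, ∫⁻ v : Pt d,
      ⨆ l₁ ∈ Metric.ball (0 : Pt d) ε, ⨆ l₂ ∈ Metric.ball (0 : Pt d) ε,
        ⨆ l₃ ∈ Metric.ball (0 : Pt d) ε,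
          ‖cum4 e P (X (l₁ + u)) (X (l₂ + v)) (X (l₃ + w)) (X 0)‖ₑ) w)
  have h1 : ∑' u : Fin d → ℤ, ∑' v : Fin d → ℤ, ENNReal.ofReal (δ ^ d) ^ 2 *
        ‖cum4 e P (X (latticePt δ u)) (X (latticePt δ v)) (X w) (X 0)‖ₑ
      = ∫⁻ x : Pt d, ∫⁻ y : Pt d, ‖cum4 e P (X (latticePt δ (cellIdx δ x)))
          (X (latticePt δ (cellIdx δ y))) (X w) (X 0)‖ₑ := by
    simp_rw [fun x : Pt d => lintegral_comp_cellIdx hδ fun v => ‖cum4 e P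
      (X (latticePt δ (cellIdx δ x))) (X (latticePt δ v)) (X w) (X 0)‖ₑ]
    rw [lintegral_comp_cellIdx hδ fun u => ENNReal.ofReal (δ ^ d) * ∑' v, ‖cum4 e P
      (X (latticePt δ u)) (X (latticePt δ v)) (X w) (X 0)‖ₑ]
    simp_rw [ENNReal.tsum_mul_left, sq, mul_assoc]
  rw [h1]
  have hball : ∀ x : Pt d, latticePt δ (cellIdx δ x) - x ∈ Metric.ball (0 : Pt d) ε := fun x =>
    mem_ball_zero_iff.2 ((norm_latticePt_cellIdx_sub_le hδ x).trans_lt hε)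
  have hε0 : 0 < ε := lt_of_le_of_lt (by positivity) hε
  refine lintegral_mono fun x => lintegral_mono fun y => ?_
  refine le_iSup₂_of_le (latticePt δ (cellIdx δ x) - x) (hball x) ?_
  refine le_iSup₂_of_le (latticePt δ (cellIdx δ y) - y) (hball y) ?_
  refine le_iSup₂_of_le (0 : Pt d) (Metric.mem_ball_self hε0) ?_
  rw [sub_add_cancel, sub_add_cancel, zero_add]

theorem FineMesh.enorm_pairWeight_le {R δ Δ a : ℝ} {N : Fin d → ℕ} {T : Set (Pt d)}
    (hM : FineMesh R δ Δ a N T) (hK : KernelAssumption K) (hR : ∀ x, K x ≠ 0 → ‖x‖ ≤ R)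
    (θ : Pt d) (m : Fin d → ℤ) :
    ‖pairWeight K δ T Δ θ (latticePt δ m)‖ₑ
      ≤ ENNReal.ofReal (δ ^ d) ^ 2 * ENNReal.ofReal (2 ^ d / volume.real T)
        * lagIndicator δ (R * Δ) m := by
  have hΔ : 0 < Δ := by linarith [hM.bandwidth_ge]
  have hδ := hM.mesh_pos
  have hV := hM.volume_pos
  by_cases h0 : K (Δ⁻¹ • latticePt δ m) = 0
  · simp [pairWeight, h0]
  have h1 := hR _ h0
  rw [norm_smul, Real.norm_of_nonneg (by positivity), inv_mul_le_iff₀ hΔ, mul_comm] at h1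
  rw [lagIndicator, if_pos h1, mul_one, ← ENNReal.ofReal_pow (by positivity),
    ← ENNReal.ofReal_mul (by positivity), ← ofReal_norm]
  refine ENNReal.ofReal_le_ofReal ?_
  have hO := hM.le_overlap h1
  have hO0 : 0 < overlap T (latticePt δ m) := lt_of_lt_of_le (by positivity) hO
  rw [pairWeight, norm_mul, norm_mul, norm_chi, one_mul, Complex.norm_real, Complex.norm_real,
    Real.norm_of_nonneg (by positivity), Real.norm_eq_abs, abs_div, abs_of_pos hO0]
  refine mul_le_mul ?_ ?_ (by positivity) (by positivity)
  · rw [← pow_mul, mul_comm d 2]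
    refine div_le_self (by positivity) (one_le_pow₀ ?_)
    linarith [Real.pi_gt_three]
  · calc _ ≤ 1 / (volume.real T / 2 ^ d) := by
          gcongr
          exact hK.abs_le_one _
      _ = _ := one_div_div _ _

/-- In each direction `N l * δ` is at most twice the side `N l * δ - a`, since `a ≤ 1` and the side
exceeds `1`. -/
theorem FineMesh.card_gridIdx_le {R δ Δ a : ℝ} {N : Fin d → ℕ} {T : Set (Pt d)}
    (hM : FineMesh R δ Δ a N T) :
    ENNReal.ofReal (δ ^ d) * ((gridIdx N).card : ℝ≥0∞)
      ≤ ENNReal.ofReal (2 ^ d * volume.real T) := by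
  have hR := hM.radius_ge; have hΔ := hM.bandwidth_ge; have hδ := hM.mesh_pos
  rw [← ENNReal.ofReal_natCast, ← ENNReal.ofReal_mul (by positivity)]
  refine ENNReal.ofReal_le_ofReal ?_
  have h1 : δ ^ d = ∏ _l : Fin d, δ := by simp
  have h2 : (2 : ℝ) ^ d = ∏ _l : Fin d, (2 : ℝ) := by simp
  rw [hM.volume_eq, gridIdx, Fintype.card_piFinset, h1, h2, Nat.cast_prod,
    ← Finset.prod_mul_distrib, ← Finset.prod_mul_distrib]
  refine Finset.prod_le_prod (fun l _ => by positivity) fun l _ => ?_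
  have h3 := hM.side_ge l; have h4 := hM.offset_le; have h5 := hM.mesh_le
  have h6 : 1 ≤ R * Δ := one_le_mul_of_one_le_of_one_le hR hΔ
  rw [Int.card_Icc]
  have h7 : ((((N l : ℤ) + 1 - 1).toNat : ℕ) : ℝ) = N l := by simp
  rw [h7]
  linarith

/-- The variance of the estimator on a fixed grid. -/
theorem FineMesh.lintegral_hsNorm_sq_le [IsProbabilityMeasure P] [Countable ι] {R δ Δ a ε : ℝ}
    {N : Fin d → ℕ} {T : Set (Pt d)}
    (hM : FineMesh R δ Δ a N T) (hX : IsStationaryRealProcess e P X)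
    (hC : AEStronglyMeasurable (covOp P X) volume)
    (hV : CumulantAssumption e P X)
    (hε : √d * δ < ε) (hK : KernelAssumption K) (hR : ∀ x, K x ≠ 0 → ‖x‖ ≤ R) (θ : Pt d) :
    ∫⁻ ω, hsNorm e (specEstimator K X δ N T Δ θ ω - ∫ ω, specEstimator K X δ N T Δ θ ω ∂P) ^ 2 ∂P
      ≤ ENNReal.ofReal (2 ^ (3 * d) * (R + 1) ^ d * (Δ ^ d / volume.real T)) *
        (volume (Metric.closedBall (0 : Pt d) 1) *
        ((⨆ w : Pt d, ∫⁻ u : Pt d, ∫⁻ v : Pt d,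
      ⨆ l₁ ∈ Metric.ball (0 : Pt d) ε, ⨆ l₂ ∈ Metric.ball (0 : Pt d) ε,
        ⨆ l₃ ∈ Metric.ball (0 : Pt d) ε,
          ‖cum4 e P (X (l₁ + u)) (X (l₂ + v)) (X (l₃ + w)) (X 0)‖ₑ) +
          2 * ((∫⁻ x, covSize e P X x) + 2 * ∫⁻ x, traceNorm e
            (covOp P X (latticePt δ (cellIdx δ x)) - covOp P X x)) ^ 2)) := by
  set Γ := ⨆ w : Pt d, ∫⁻ u : Pt d, ∫⁻ v : Pt d,
      ⨆ l₁ ∈ Metric.ball (0 : Pt d) ε, ⨆ l₂ ∈ Metric.ball (0 : Pt d) ε,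
        ⨆ l₃ ∈ Metric.ball (0 : Pt d) ε,
          ‖cum4 e P (X (l₁ + u)) (X (l₂ + v)) (X (l₃ + w)) (X 0)‖ₑ with hΓ
  set S := (∫⁻ x, covSize e P X x) + 2 * ∫⁻ x, traceNorm e
            (covOp P X (latticePt δ (cellIdx δ x)) - covOp P X x) with hS
  have hδ := hM.mesh_pos
  have hΔ1 := hM.bandwidth_ge
  have hR1 := hM.radius_ge
  have hT := hM.volume_pos
  set D := ENNReal.ofReal (δ ^ d) with hD
  set A := D ^ 2 * ENNReal.ofReal (2 ^ d / volume.real T) with hA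
  set b : (Fin d → ℤ) → ℝ≥0∞ := lagIndicator δ (R * Δ) with hb
  set ρ : (Fin d → ℤ) → ℝ≥0∞ := fun m => D * covSize e P X (latticePt δ m) with hρ
  set κ : (Fin d → ℤ) → (Fin d → ℤ) → (Fin d → ℤ) → ℝ≥0∞ := fun u v w => D ^ 2 *
    ‖cum4 e P (X (latticePt δ u)) (X (latticePt δ v)) (X (latticePt δ w)) (X 0)‖ₑ with hκ
  set B := gridIdx N with hB
  have hcov : ∀ p q : (Fin d → ℤ) × (Fin d → ℤ),
      D ^ 2 * ‖(∫ ω, hsInner e (rankOne ℂ (X (latticePt δ p.1) ω) (X (latticePt δ p.2) ω))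
          (rankOne ℂ (X (latticePt δ q.1) ω) (X (latticePt δ q.2) ω)) ∂P)
        - hsInner e (crossCov P (X (latticePt δ p.1)) (X (latticePt δ p.2)))
          (crossCov P (X (latticePt δ q.1)) (X (latticePt δ q.2)))‖ₑ
      ≤ κ (p.1 - q.2) (p.2 - q.2) (q.1 - q.2) + ρ (q.1 - p.1) * ρ (p.2 - q.2)
          + ρ (p.1 - q.2) * ρ (q.1 - p.2) := by
    intro p q
    have h1 := hX.enorm_cov_rankOne_le (latticePt δ p.1) (latticePt δ p.2) (latticePt δ q.1)
      (latticePt δ q.2)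
    -- Translating by the fourth point leaves three lags and the origin, the form in which the
    -- cumulants are summable.
    have h2 := hV.cum_shift (latticePt δ (p.1 - q.2)) (latticePt δ (p.2 - q.2))
      (latticePt δ (q.1 - q.2)) 0 (latticePt δ q.2)
    simp only [← latticePt_sub] at h1
    simp only [latticePt_sub, sub_add_cancel, zero_add] at h2
    rw [h2] at h1
    simp only [← latticePt_sub] at h1
    refine (mul_le_mul_right h1 (D ^ 2)).trans_eq ?_
    simp only [hκ, hρ]
    ring
  have hκs : ∀ w, ∑' u, ∑' v, κ u v w ≤ Γ := fun w => tsum_tsum_cum4_le hδ hε (latticePt δ w)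
  have hρs : ∑' m, ρ m ≤ S := by
    rw [hρ, ENNReal.tsum_mul_left]
    exact tsum_covSize_le hδ hC
  have hbs : D * ∑' m, b m
      ≤ ENNReal.ofReal (((R + 1) * Δ) ^ d) * volume (Metric.closedBall (0 : Pt d) 1) :=
    tsum_lagIndicator_le hδ (by linarith [hM.mesh_lt]) (by positivity)
  have hcard := hM.card_gridIdx_le
  have hvar : ∫⁻ ω, hsNorm e (specEstimator K X δ N T Δ θ ω
      - ∫ ω, specEstimator K X δ N T Δ θ ω ∂P) ^ 2 ∂P
      ≤ ∑ p ∈ B ×ˢ B, ∑ q ∈ B ×ˢ B, ‖pairWeight K δ T Δ θ (latticePt δ (p.1 - p.2))‖ₑ *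
        ‖pairWeight K δ T Δ θ (latticePt δ (q.1 - q.2))‖ₑ *
        ‖(∫ ω, hsInner e (rankOne ℂ (X (latticePt δ p.1) ω) (X (latticePt δ p.2) ω))
          (rankOne ℂ (X (latticePt δ q.1) ω) (X (latticePt δ q.2) ω)) ∂P)
        - hsInner e (crossCov P (X (latticePt δ p.1)) (X (latticePt δ p.2)))
          (crossCov P (X (latticePt δ q.1)) (X (latticePt δ q.2)))‖ₑ := by
    rw [hX.integral_specEstimator hδ]
    simp_rw [specEstimator_eq_sum hδ, ← Finset.sum_sub_distrib, ← smul_sub]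
    exact lintegral_hsNorm_sq_sum_centered_le e (B ×ˢ B)
      (fun p => pairWeight K δ T Δ θ (latticePt δ (p.1 - p.2)))
      (Y := fun p => X (latticePt δ p.1)) (Z := fun p => X (latticePt δ p.2))
      (fun p => hV.memLp_four _) (fun p => hV.memLp_four _)
  -- The two weights carry `D ^ 4`. Two factors `D` normalise the covariance terms, one the number
  -- of grid points and one the number of lags.
  have hfac : ∫⁻ ω, hsNorm e (specEstimator K X δ N T Δ θ ω
      - ∫ ω, specEstimator K X δ N T Δ θ ω ∂P) ^ 2 ∂P
      ≤ (D * ENNReal.ofReal (2 ^ d / volume.real T)) ^ 2 *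
        ((B.card : ℝ≥0∞) * (∑' m, b m) * (Γ + 2 * (∑' m, ρ m) ^ 2)) := by
    refine hvar.trans (le_trans ?_ (mul_le_mul_right (sum_sum_pairs_le B b ρ
      (lagIndicator_le_one δ _) κ hκs) _))
    simp_rw [Finset.mul_sum]
    refine Finset.sum_le_sum fun p _ => Finset.sum_le_sum fun q _ => ?_
    have hring : ∀ c, (A * b (p.1 - p.2)) * (A * b (q.1 - q.2)) * c
        = (D * ENNReal.ofReal (2 ^ d / volume.real T)) ^ 2 *
            (b (p.1 - p.2) * b (q.1 - q.2) * (D ^ 2 * c)) := fun c => by rw [hA]; ring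
    refine (mul_le_mul' (mul_le_mul' (hM.enorm_pairWeight_le hK hR θ _)
      (hM.enorm_pairWeight_le hK hR θ _)) le_rfl).trans ?_
    rw [hring]
    gcongr
    exact hcov p q
  calc _ ≤ _ := hfac
    _ = ENNReal.ofReal (2 ^ d / volume.real T) ^ 2 * (D * B.card) * (D * ∑' m, b m) *
        (Γ + 2 * (∑' m, ρ m) ^ 2) := by ring
    _ ≤ ENNReal.ofReal (2 ^ d / volume.real T) ^ 2 * ENNReal.ofReal (2 ^ d * volume.real T) *
        (ENNReal.ofReal (((R + 1) * Δ) ^ d) * volume (Metric.closedBall (0 : Pt d) 1)) *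
        (Γ + 2 * S ^ 2) := by gcongr
    _ = _ := by
        have h1 : ENNReal.ofReal (2 ^ d / volume.real T) ^ 2
            * ENNReal.ofReal (2 ^ d * volume.real T) * ENNReal.ofReal (((R + 1) * Δ) ^ d)
            = ENNReal.ofReal (2 ^ (3 * d) * (R + 1) ^ d * (Δ ^ d / volume.real T)) := by
          rw [← ENNReal.ofReal_pow (by positivity), ← ENNReal.ofReal_mul (by positivity),
            ← ENNReal.ofReal_mul (by positivity)]
          congr 1
          rw [mul_pow, pow_mul', mul_comm]
          field_simp
        rw [← h1]
        ring

end Variance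

/-! ### From the sampling asymptotics to fixed-grid bounds. -/

section Assembly

variable {d : ℕ}

/-- Treats both regions as one box with lower corner `a`, equal to `δ n` for the hull and `0` for
the cell box. Positive volume excludes an empty grid. -/
theorem SamplingAssumption.eventually_region_eq {δ : ℕ → ℝ} {N : ℕ → Fin d → ℕ}
    {T : ℕ → Set (Pt d)}
    (hT : (∀ n, T n = gridHull (δ n) (N n)) ∨ (∀ n, T n = gridBox (δ n) (N n)))
    (hS : SamplingAssumption δ T) :
    ∀ᶠ n in atTop, ∃ a, 0 ≤ a ∧ a ≤ δ n ∧ T n = closedBox (fun _ => a) (fun l => N n l * δ n) ∧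
      ∀ l, a ≤ N n l * δ n := by
  filter_upwards [hS.volume_tendsto.eventually_gt_atTop 0] with n hn
  have hδ := hS.delta_pos n
  rcases hT with hT | hT
  · have hN : ∀ l, 1 ≤ N n l := by
      by_contra hcon
      rw [hT n, gridHull, gridPoints_eq_empty hcon] at hn
      simp [closedConvexHull_eq_closure_convexHull] at hn
    refine ⟨δ n, hδ.le, le_rfl, (hT n).trans (gridHull_eq_closedBox hδ hN), fun l => ?_⟩
    have : (1 : ℝ) ≤ N n l := by exact_mod_cast hN l
    nlinarith
  · exact ⟨0, le_rfl, hδ.le, hT n, fun l => by positivity⟩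

/-- The sides of a box which, after rescaling to unit volume, stays close to a bounded set are
comparable to those of a cube of the same volume. -/
theorem rpow_volume_le_side {p q : Fin d → ℝ} (hpq : ∀ l, p l ≤ q l)
    (hV : 0 < volume.real (closedBox p q)) {T₀ : Set (Pt d)} {D : ℝ}
    (hD : ∀ x ∈ T₀, ∀ y ∈ T₀, dist x y ≤ D)
    (hT₀ : Metric.hausdorffEDist
      ((volume.real (closedBox p q) ^ (-(1 / (d : ℝ)))) • closedBox p q) T₀ < 1) (l : Fin d) :
    volume.real (closedBox p q) ^ (1 / (d : ℝ)) ≤ (D + 2) ^ (d - 1) * (q l - p l) := by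
  have hd : 0 < d := Fin.pos l
  set V := volume.real (closedBox p q) with hVdef
  set v := V ^ (1 / (d : ℝ)) with hv
  have hv0 : 0 < v := Real.rpow_pos_of_pos hV _
  have hvd : v ^ d = V := by
    rw [hv, ← Real.rpow_natCast, ← Real.rpow_mul hV.le, one_div_mul_cancel (by positivity),
      Real.rpow_one]
  have hs : V ^ (-(1 / (d : ℝ))) = v⁻¹ := by rw [Real.rpow_neg hV.le]
  rw [hs] at hT₀
  -- Two points of the box differing only in coordinate `i` are, after rescaling, each within `1` of
  -- `T₀`, whose diameter is at most `D`.
  have hup : ∀ i, q i - p i ≤ (D + 2) * v := by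
    intro i
    set y : Pt d := WithLp.toLp 2 p with hy
    set x : Pt d := WithLp.toLp 2 (Function.update p i (q i)) with hx
    have hyT : v⁻¹ • y ∈ v⁻¹ • closedBox p q :=
      Set.smul_mem_smul_set fun j => ⟨le_rfl, hpq j⟩
    have hxT : v⁻¹ • x ∈ v⁻¹ • closedBox p q := by
      refine Set.smul_mem_smul_set fun j => ?_
      by_cases hj : j = i
      · subst hj; simp [hx, hpq j]
      · simp [hx, hj, hpq j]
    obtain ⟨y', hy', hyy⟩ := Metric.exists_edist_lt_of_hausdorffEDist_lt hyT hT₀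
    obtain ⟨x', hx', hxx⟩ := Metric.exists_edist_lt_of_hausdorffEDist_lt hxT hT₀
    have h1 : dist (v⁻¹ • y) y' < 1 := by
      rw [edist_dist, ← ENNReal.ofReal_one] at hyy
      exact (ENNReal.ofReal_lt_ofReal_iff one_pos).1 hyy
    have h2 : dist (v⁻¹ • x) x' < 1 := by
      rw [edist_dist, ← ENNReal.ofReal_one] at hxx
      exact (ENNReal.ofReal_lt_ofReal_iff one_pos).1 hxx
    have h3 : dist (v⁻¹ • x) (v⁻¹ • y) ≤ D + 2 := by
      have h4 := dist_triangle4 (v⁻¹ • x) x' y' (v⁻¹ • y)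
      have h5 := hD x' hx' y' hy'
      rw [dist_comm y'] at h4
      linarith
    have h6 : v⁻¹ * (q i - p i) ≤ dist (v⁻¹ • x) (v⁻¹ • y) := by
      rw [dist_eq_norm, ← smul_sub, norm_smul, Real.norm_of_nonneg (by positivity)]
      gcongr
      refine (le_abs_self _).trans ?_
      have := PiLp.norm_apply_le (x - y) i
      simpa [hx, hy] using this
    have h7 := h6.trans h3
    rw [inv_mul_le_iff₀ hv0] at h7
    linarith
  -- With the volume `v ^ d` fixed and the other `d - 1` sides bounded above, the remaining side
  -- cannot be small.
  have hprod : V = (q l - p l) * ∏ i ∈ Finset.univ.erase l, (q i - p i) := by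
    rw [hVdef, volume_real_closedBox hpq,
      Finset.mul_prod_erase _ (fun i => q i - p i) (Finset.mem_univ l)]
  have hle : ∏ i ∈ Finset.univ.erase l, (q i - p i) ≤ ((D + 2) * v) ^ (d - 1) := by
    refine (Finset.prod_le_prod (fun i _ => sub_nonneg.2 (hpq i)) fun i _ => hup i).trans_eq ?_
    rw [Finset.prod_const, Finset.card_erase_of_mem (Finset.mem_univ l), Finset.card_univ,
      Fintype.card_fin]
  have h8 : v * v ^ (d - 1) ≤ ((D + 2) ^ (d - 1) * (q l - p l)) * v ^ (d - 1) := by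
    rw [← pow_succ', Nat.sub_add_cancel hd, hvd]
    calc V ≤ (q l - p l) * ((D + 2) * v) ^ (d - 1) := by
          conv_lhs => rw [hprod]
          exact mul_le_mul_of_nonneg_left hle (sub_nonneg.2 (hpq l))
      _ = _ := by rw [mul_pow]; ring
  exact le_of_mul_le_mul_right h8 (by positivity)

/-- All sides are at least a constant times `|T|^{1/d}`, which eventually exceeds any fixed multiple
of the bandwidth. -/
theorem SamplingAssumption.eventually_fineMesh {δ : ℕ → ℝ} {N : ℕ → Fin d → ℕ}
    {T : ℕ → Set (Pt d)} {Δ : ℕ → ℝ}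
    (hT : (∀ n, T n = gridHull (δ n) (N n)) ∨ (∀ n, T n = gridBox (δ n) (N n)))
    (hS : SamplingAssumption δ T) (hΔ : Tendsto Δ atTop atTop)
    (hΔT : Tendsto (fun n => Δ n ^ d / volume.real (T n)) atTop (𝓝 0)) {R : ℝ} (hR : 1 ≤ R) :
    ∀ᶠ n in atTop, ∃ a, FineMesh R (δ n) (Δ n) a (N n) (T n) := by
  obtain ⟨T₀, hT₀, -, -, hlim⟩ := hS.shape
  obtain ⟨D, hD⟩ := hT₀.subset_closedBall 0
  set D' := max (2 * D) 0 with hD'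
  have hDD : ∀ x ∈ T₀, ∀ y ∈ T₀, dist x y ≤ D' := by
    intro x hx y hy
    have h1 := hD hx
    have h2 := hD hy
    rw [Metric.mem_closedBall] at h1 h2
    have := dist_triangle_right x y 0
    exact le_trans (by linarith) (le_max_left _ _)
  -- Chosen so that every side is at least `4 * R * Δ`, hence at least `2 * (R * Δ + 1)` because `R
  -- * Δ ≥ 1`.
  set c := 4 * R * (D' + 2) ^ (d - 1) with hc
  have hD'0 : 0 ≤ D' := le_max_right _ _
  have hc0 : 0 < c := by positivity
  have hmesh : Tendsto (fun n => √d * δ n) atTop (𝓝 0) := by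
    simpa using hS.delta_tendsto.const_mul (√d)
  filter_upwards [hS.eventually_region_eq hT, hS.volume_tendsto.eventually_gt_atTop 0,
    hΔ.eventually_ge_atTop 1, hlim.eventually_lt_const one_pos,
    hΔT.eventually_lt_const (u := 1 / c ^ d) (by positivity),
    hmesh.eventually_lt_const one_pos, hS.delta_tendsto.eventually_lt_const one_pos]
    with n hn hV hΔ1 hH hsmall hm1 hm2
  obtain ⟨a, ha0, haδ, hTa, hside⟩ := hn
  refine ⟨a, ⟨hR, hS.delta_pos n, hm2.le, hm1, hΔ1, ha0, haδ, hTa, fun l => ?_⟩⟩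
  rw [hTa] at hH hV hsmall
  have h1 := rpow_volume_le_side hside hV hDD hH l
  set V := volume.real (closedBox (fun _ => a) fun l => (N n l : ℝ) * δ n) with hVdef
  have hd : 0 < d := Fin.pos l
  have hvd : (V ^ (1 / (d : ℝ))) ^ d = V := by
    rw [← Real.rpow_natCast, ← Real.rpow_mul hV.le, one_div_mul_cancel (by positivity),
      Real.rpow_one]
  have h2 : c * Δ n ≤ V ^ (1 / (d : ℝ)) := by
    rw [← pow_le_pow_iff_left₀ (by positivity) (by positivity) hd.ne', hvd, mul_pow]
    rw [div_lt_div_iff₀ hV (by positivity)] at hsmall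
    linarith
  have h3 : (D' + 2) ^ (d - 1) * (4 * R * Δ n)
      ≤ (D' + 2) ^ (d - 1) * (N n l * δ n - a) := by
    refine le_trans (le_of_eq ?_) (h2.trans h1)
    rw [hc]; ring
  have h4 := le_of_mul_le_mul_left h3 (by positivity)
  have h5 : 1 ≤ R * Δ n := one_le_mul_of_one_le_of_one_le hR hΔ1
  linarith

variable {H : Type*} [NormedAddCommGroup H] [InnerProductSpace ℂ H] [CompleteSpace H]
  {ι Ω : Type*} [MeasurableSpace Ω] {P : Measure Ω} {e : HilbertBasis ι ℂ H}
  {X : Pt d → Ω → H} {K : Pt d → ℝ}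

/-- The corner of a cell lies in the closed ball of radius `√d * δ` around each of its points; `1 ≤
d` makes this radius positive, as the Hölder condition requires. -/
theorem CovAssumption.exists_lintegral_cellIdx_le {γ : ℝ} {C : Pt d → H →L[ℂ] H}
    (hC : CovAssumption e γ C) (hd : 1 ≤ d) : ∃ M : ℝ, 0 ≤ M ∧ ∀ δ : ℝ, 0 < δ → √d * δ < 1 →
      ∫⁻ x, traceNorm e (C (latticePt δ (cellIdx δ x)) - C x)
        ≤ ENNReal.ofReal (M * (√d * δ) ^ γ) := by
  obtain ⟨M, hM⟩ := hC.holder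
  refine ⟨max M 0, le_max_right _ _, fun δ hδ hδ1 => ?_⟩
  have hd' : (0 : ℝ) < d := by exact_mod_cast hd
  have hpos : 0 < √d * δ := by positivity
  refine (lintegral_mono fun x => ?_).trans ((hM _ hpos hδ1).trans ?_)
  · refine le_iSup₂_of_le (latticePt δ (cellIdx δ x)) ?_ le_rfl
    rw [mem_closedBall_iff_norm]
    exact norm_latticePt_cellIdx_sub_le hδ x
  · refine ENNReal.ofReal_le_ofReal ?_
    have := Real.rpow_nonneg hpos.le γ
    gcongr
    exact le_max_left _ _

/-- The bias bound with a constant that depends only on the process and the kernel. -/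
theorem exists_bias_le [Countable ι] (hd : 1 ≤ d) (hX : IsStationaryRealProcess e P X)
    {γ : ℝ} (hC : CovAssumption e γ (covOp P X)) (hK : KernelAssumption K)
    {R : ℝ} (hR : ∀ x, K x ≠ 0 → ‖x‖ ≤ R)
    {β L : ℝ} (hβ : 0 < β) (hL : 0 < L) (hf : spectralDensity P X ∈ powerLawClass e d β L)
    {lam : ℕ} (hlamβ : β - 1 < (lam : ℝ)) (hflat : KernelFlat K lam)
    {Θ : Set (Pt d)} (hΘ : Bornology.IsBounded Θ) :
    ∃ c : ℝ, 0 ≤ c ∧ ∀ (δ Δ a : ℝ) (N : Fin d → ℕ) (T : Set (Pt d)), FineMesh R δ Δ a N T →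
      ∀ θ ∈ Θ, hsNorm e ((∫ ω, specEstimator K X δ N T Δ θ ω ∂P) - spectralDensity P X θ)
        ≤ ENNReal.ofReal (c * (δ ^ γ + Δ ^ (-β))) := by
  obtain ⟨M, hM0, hM⟩ := hC.exists_lintegral_cellIdx_le hd
  obtain ⟨A, hA0, hA⟩ := hflat.exists_lipschitz hK
  obtain ⟨B, hB0, hB⟩ := KernelFlat.exists_abs_sub_one_le_rpow hK hflat hβ hlamβ
  obtain ⟨r, hr⟩ := hΘ.exists_norm_le
  have hint := integrable_of_lintegral_traceNorm hC.measurable hC.integrable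
  have hI : ∫⁻ x, hsNorm e (covOp P X x) < ∞ :=
    (lintegral_mono fun x => hsNorm_le_traceNorm e _).trans_lt hC.integrable
  set I := (∫⁻ x, hsNorm e (covOp P X x)).toReal with hIdef
  have hI' : ∫⁻ x, hsNorm e (covOp P X x) = ENNReal.ofReal I := (ENNReal.ofReal_toReal hI.ne).symm
  have hI0 : 0 ≤ I := ENNReal.toReal_nonneg
  set r' := max r 0 with hr'
  have hr'0 : 0 ≤ r' := le_max_right _ _
  refine ⟨(1 + 2 ^ d) * (M * √d ^ γ) + (2 ^ d + √d * r' + A * √d) * I + B * L, ?_, ?_⟩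
  · have : 0 ≤ √(d : ℝ) ^ γ := Real.rpow_nonneg (Real.sqrt_nonneg _) γ
    positivity
  intro δ Δ a N T hF θ hθ
  have hδ := hF.mesh_pos
  have hΔ : 0 < Δ := by linarith [hF.bandwidth_ge]
  -- Absorbs all errors of order `δ` into the rate `δ ^ γ`, by `γ ≤ 1` and `δ ≤ 1`.
  have hδγ : δ ≤ δ ^ γ := by
    simpa using Real.rpow_le_rpow_of_exponent_ge hδ hF.mesh_le hC.gamma_le_one
  have hδγ0 : 0 < δ ^ γ := Real.rpow_pos_of_pos hδ γ
  have hΔβ0 : 0 < Δ ^ (-β) := Real.rpow_pos_of_pos hΔ _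
  have hdγ0 : 0 ≤ √(d : ℝ) ^ γ := Real.rpow_nonneg (Real.sqrt_nonneg _) γ
  have h1 : ∫⁻ x, hsNorm e (covOp P X (latticePt δ (cellIdx δ x)) - covOp P X x)
      ≤ ENNReal.ofReal (M * √d ^ γ * δ ^ γ) := by
    refine (lintegral_mono fun x => hsNorm_le_traceNorm e _).trans
      ((hM δ hδ hF.mesh_lt).trans_eq ?_)
    rw [Real.mul_rpow (Real.sqrt_nonneg _) hδ.le, mul_assoc]
  have h2 := lintegral_rpow_mul_hsNorm_le hint hf
  refine (hF.hsNorm_bias_le hX hint hK hR hA0 hA hB0 hB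
    ((hr θ hθ).trans (le_max_left r 0))).trans ?_
  rw [hI']
  calc _ ≤ ENNReal.ofReal (1 + 2 ^ d) * ENNReal.ofReal (M * √d ^ γ * δ ^ γ)
        + (ENNReal.ofReal ((2 ^ d + √d * r' + A * √d) * δ) * ENNReal.ofReal I
        + ENNReal.ofReal (B * Δ ^ (-β)) * ENNReal.ofReal L) := by gcongr
    _ = ENNReal.ofReal ((1 + 2 ^ d) * (M * √d ^ γ * δ ^ γ)
        + ((2 ^ d + √d * r' + A * √d) * δ * I + B * Δ ^ (-β) * L)) := by
        rw [← ENNReal.ofReal_mul (by positivity), ← ENNReal.ofReal_mul (by positivity),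
          ← ENNReal.ofReal_mul (by positivity), ← ENNReal.ofReal_add (by positivity)
          (by positivity), ← ENNReal.ofReal_add (by positivity) (by positivity)]
    _ ≤ _ := by
        refine ENNReal.ofReal_le_ofReal ?_
        set a1 := (1 + 2 ^ d) * (M * √d ^ γ) with ha1
        set a2 := (2 ^ d + √d * r' + A * √d) * I with ha2
        set a3 := B * L with ha3
        have e1 : (1 + 2 ^ d) * (M * √d ^ γ * δ ^ γ)
            + ((2 ^ d + √d * r' + A * √d) * δ * I + B * Δ ^ (-β) * L)
            = a1 * δ ^ γ + a2 * δ + a3 * Δ ^ (-β) := by rw [ha1, ha2, ha3]; ring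
        have b1 : 0 ≤ a1 := by positivity
        have b2 : 0 ≤ a2 := by positivity
        have b3 : 0 ≤ a3 := by positivity
        rw [e1]
        nlinarith [mul_le_mul_of_nonneg_left hδγ b2, mul_nonneg b1 hΔβ0.le,
          mul_nonneg b2 hΔβ0.le, mul_nonneg b3 hδγ0.le]

/-- The variance bound with a constant that depends only on the process and the kernel. -/
theorem exists_variance_le [IsProbabilityMeasure P] [Countable ι] (hd : 1 ≤ d)
    (hX : IsStationaryRealProcess e P X)
    {γ : ℝ} (hC : CovAssumption e γ (covOp P X)) (hV : CumulantAssumption e P X)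
    (hK : KernelAssumption K) {R : ℝ} (hR1 : 1 ≤ R) (hR : ∀ x, K x ≠ 0 → ‖x‖ ≤ R) :
    ∃ c ε : ℝ, 0 ≤ c ∧ 0 < ε ∧ ∀ (δ Δ a : ℝ) (N : Fin d → ℕ) (T : Set (Pt d)),
      FineMesh R δ Δ a N T → √d * δ < ε → ∀ θ,
      ∫⁻ ω, hsNorm e (specEstimator K X δ N T Δ θ ω
          - ∫ ω, specEstimator K X δ N T Δ θ ω ∂P) ^ 2 ∂P
        ≤ ENNReal.ofReal (c * (Δ ^ d / volume.real T)) := by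
  obtain ⟨M, hM0, hM⟩ := hC.exists_lintegral_cellIdx_le hd
  obtain ⟨ε, hε, hΓ⟩ := hV.cum_integrable
  set Γ := ⨆ w : Pt d, ∫⁻ u : Pt d, ∫⁻ v : Pt d,
      ⨆ l₁ ∈ Metric.ball (0 : Pt d) ε, ⨆ l₂ ∈ Metric.ball (0 : Pt d) ε,
        ⨆ l₃ ∈ Metric.ball (0 : Pt d) ε,
          ‖cum4 e P (X (l₁ + u)) (X (l₂ + v)) (X (l₃ + w)) (X 0)‖ₑ with hΓdef
  set Q := volume (Metric.closedBall (0 : Pt d) 1) *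
    (Γ + 2 * ((∫⁻ x, covSize e P X x) + 2 * ENNReal.ofReal M) ^ 2) with hQ
  have hρ := lintegral_covSize_lt_top (e := e) hC.measurable hC.integrable
  have hQt : Q ≠ ∞ := by
    refine ENNReal.mul_ne_top measure_closedBall_lt_top.ne (ENNReal.add_ne_top.2 ⟨hΓ.ne, ?_⟩)
    exact ENNReal.mul_ne_top (by simp) (ENNReal.pow_ne_top (ENNReal.add_ne_top.2
      ⟨hρ.ne, ENNReal.mul_ne_top (by simp) ENNReal.ofReal_ne_top⟩))
  refine ⟨2 ^ (3 * d) * (R + 1) ^ d * Q.toReal, ε, by positivity, hε,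
    fun δ Δ a N T hF hδε θ => ?_⟩
  have hδ := hF.mesh_pos
  have hΔ : 0 < Δ := by linarith [hF.bandwidth_ge]
  have hT := hF.volume_pos
  refine (hF.lintegral_hsNorm_sq_le hX hC.measurable hV hδε hK hR θ).trans ?_
  have h1 : ∫⁻ x, traceNorm e (covOp P X (latticePt δ (cellIdx δ x)) - covOp P X x)
      ≤ ENNReal.ofReal M := by
    refine (hM δ hδ hF.mesh_lt).trans (ENNReal.ofReal_le_ofReal ?_)
    exact mul_le_of_le_one_right hM0
      (Real.rpow_le_one (by positivity) hF.mesh_lt.le hC.gamma_pos.le)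
  calc _ ≤ ENNReal.ofReal (2 ^ (3 * d) * (R + 1) ^ d * (Δ ^ d / volume.real T)) * Q := by
        rw [hQ]; gcongr
    _ = _ := by
        rw [← ENNReal.ofReal_toReal hQt, ← ENNReal.ofReal_mul (by positivity),
          ENNReal.toReal_ofReal ENNReal.toReal_nonneg]
        congr 1
        ring

theorem ENNReal.add_sq_le (a b : ℝ≥0∞) : (a + b) ^ 2 ≤ 2 * a ^ 2 + 2 * b ^ 2 := by
  have h := add_le_add_right (ENNReal.two_mul_mul_le_sq_add_sq a b) (a ^ 2 + b ^ 2)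
  calc (a + b) ^ 2 = a ^ 2 + b ^ 2 + 2 * (a * b) := by ring
    _ ≤ _ := h
    _ = _ := by ring

end Assembly

/-! ### Combination of bias and variance. -/

theorem mainTheorem8
    {H : Type*} [NormedAddCommGroup H] [InnerProductSpace ℂ H] [CompleteSpace H]
    [TopologicalSpace.SeparableSpace H]
    {ι : Type*} (e : HilbertBasis ι ℂ H)
    {Ω : Type*} [MeasurableSpace Ω] (P : Measure Ω) [IsProbabilityMeasure P]
    {d : ℕ} (hd : 1 ≤ d)
    (X : Pt d → Ω → H) (hX : IsStationaryRealProcess e P X)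
    (γ : ℝ) (hC : CovAssumption e γ (covOp P X))
    (hV : CumulantAssumption e P X)
    (K : Pt d → ℝ) (hK : KernelAssumption K)
    (δ : ℕ → ℝ) (N : ℕ → Fin d → ℕ) (T : ℕ → Set (Pt d))
    (hT : (∀ n, T n = gridHull (δ n) (N n)) ∨ (∀ n, T n = gridBox (δ n) (N n)))
    (hS : SamplingAssumption δ T)
    (β L : ℝ) (hβ : 0 < β) (hL : 0 < L)
    (hf : spectralDensity P X ∈ powerLawClass e d β L)
    (lam : ℕ) (hlam : 0 < lam) (hlamβ : β - 1 < (lam : ℝ)) (hflat : KernelFlat K lam)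
    (Θ : Set (Pt d)) (hΘ : Bornology.IsBounded Θ) :
    -- the bias bound
    (∀ Δ : ℕ → ℝ, Tendsto Δ atTop atTop →
      (∀ᶠ n in atTop, Δ n • kernelSupport K ⊆ T n - T n) →
      Tendsto (fun n => Δ n ^ d / volume.real (T n)) atTop (𝓝 0) →
      ∃ c : ℝ, ∀ᶠ n in atTop, ∀ θ ∈ Θ,
        hsNorm e ((∫ ω, specEstimator K X (δ n) (N n) (T n) (Δ n) θ ω ∂P)
            - spectralDensity P X θ)
          ≤ ENNReal.ofReal (c * (δ n ^ γ + Δ n ^ (-β)))) ∧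
    -- the root mean squared error bound with the rate-optimal bandwidth
    (∃ c : ℝ, ∀ᶠ n in atTop, ∀ θ ∈ Θ,
      (∫⁻ ω, hsNorm e (specEstimator K X (δ n) (N n) (T n)
          (volume.real (T n) ^ (1 / (2 * β + (d : ℝ)))) θ ω - spectralDensity P X θ) ^ 2 ∂P)
            ^ (1 / 2 : ℝ)
        ≤ ENNReal.ofReal
            (c * max (δ n ^ γ) (volume.real (T n) ^ (-β / (2 * β + (d : ℝ)))))) := by
  have : Countable ι := countable_of_separable e
  obtain ⟨R, hR1, hR⟩ := hK.exists_radius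
  obtain ⟨cb, hcb0, hcb⟩ := exists_bias_le hd hX hC hK hR hβ hL hf hlamβ hflat hΘ
  obtain ⟨cv, ε, hcv0, hε, hcv⟩ := exists_variance_le hd hX hC hV hK hR1 hR
  -- With `m` the maximum of the two rates, the variance is at most `cv * m ^ 2` and the bias at
  -- most `2 * cb * m`; doubling the variance and the squared bias gives the constant under the
  -- root.
  refine ⟨fun Δ hΔ _ hΔT => ⟨cb, ?_⟩, √(2 * cv + 8 * cb ^ 2), ?_⟩
  · filter_upwards [hS.eventually_fineMesh hT hΔ hΔT hR1] with n ⟨a, hF⟩ θ hθ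
    exact hcb _ _ _ _ _ hF θ hθ
  · have hexp : 0 < 2 * β + (d : ℝ) := by positivity
    have hd0 : (0 : ℝ) < d := by exact_mod_cast hd
    have hΔ : Tendsto (fun n => volume.real (T n) ^ (1 / (2 * β + (d : ℝ)))) atTop atTop :=
      (tendsto_rpow_atTop (by positivity)).comp hS.volume_tendsto
    -- The balance behind the bandwidth: the variance order `Δ^d / V` is the square of the bias rate
    -- `Δ^{-β}`.
    have hpow : ∀ V : ℝ, 0 < V → (V ^ (1 / (2 * β + (d : ℝ)))) ^ d / V
        = (V ^ (-β / (2 * β + (d : ℝ)))) ^ 2 := by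
      intro V hV
      rw [← Real.rpow_natCast, ← Real.rpow_natCast, ← Real.rpow_mul hV.le, ← Real.rpow_mul hV.le,
        ← Real.rpow_sub_one hV.ne']
      congr 1
      push_cast
      field_simp
      ring
    have hΔT : Tendsto (fun n => (volume.real (T n) ^ (1 / (2 * β + (d : ℝ)))) ^ d
        / volume.real (T n)) atTop (𝓝 0) := by
      have h1 : Tendsto (fun n => (volume.real (T n) ^ (-(β / (2 * β + (d : ℝ))))) ^ 2)
          atTop (𝓝 0) := by
        simpa using ((tendsto_rpow_neg_atTop (y := β / (2 * β + (d : ℝ)))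
          (by positivity)).comp hS.volume_tendsto).pow 2
      refine h1.congr' ?_
      filter_upwards [hS.volume_tendsto.eventually_gt_atTop 0] with n hn
      rw [hpow _ hn, neg_div]
    have hmesh : Tendsto (fun n => √d * δ n) atTop (𝓝 0) := by
      simpa using hS.delta_tendsto.const_mul (√d)
    filter_upwards [hS.eventually_fineMesh hT hΔ hΔT hR1, hmesh.eventually_lt_const hε]
      with n ⟨a, hF⟩ hδε θ hθ
    have hVn := hF.volume_pos
    have hb := hcb _ _ _ _ _ hF θ hθ
    have hv := hcv _ _ _ _ _ hF hδε θ
    set V := volume.real (T n) with hVdef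
    set F := fun ω => specEstimator K X (δ n) (N n) (T n) (V ^ (1 / (2 * β + (d : ℝ)))) θ ω
      with hFdef
    set m := max (δ n ^ γ) (V ^ (-β / (2 * β + (d : ℝ)))) with hm
    have hm0 : 0 ≤ m := le_max_of_le_right (Real.rpow_nonneg hVn.le _)
    have hVm : V ^ (-β / (2 * β + (d : ℝ))) ≤ m := le_max_right _ _
    have hVm0 : 0 ≤ V ^ (-β / (2 * β + (d : ℝ))) := Real.rpow_nonneg hVn.le _
    have hb' : hsNorm e ((∫ ω, F ω ∂P) - spectralDensity P X θ) ≤ ENNReal.ofReal (2 * cb * m) := by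
      refine hb.trans (ENNReal.ofReal_le_ofReal ?_)
      have h1 : (V ^ (1 / (2 * β + (d : ℝ)))) ^ (-β) = V ^ (-β / (2 * β + (d : ℝ))) := by
        rw [← Real.rpow_mul hVn.le]
        congr 1
        ring
      rw [h1, mul_comm 2 cb, mul_assoc]
      refine mul_le_mul_of_nonneg_left ?_ hcb0
      linarith [le_max_left (δ n ^ γ) (V ^ (-β / (2 * β + (d : ℝ))))]
    have hv' : ∫⁻ ω, hsNorm e (F ω - ∫ ω, F ω ∂P) ^ 2 ∂P ≤ ENNReal.ofReal (cv * m ^ 2) := by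
      refine hv.trans (ENNReal.ofReal_le_ofReal ?_)
      rw [hpow V hVn]
      gcongr
    have hmse : ∫⁻ ω, hsNorm e (F ω - spectralDensity P X θ) ^ 2 ∂P
        ≤ ENNReal.ofReal ((2 * cv + 8 * cb ^ 2) * m ^ 2) := by
      calc _ ≤ ∫⁻ ω, (2 * hsNorm e (F ω - ∫ ω, F ω ∂P) ^ 2
            + 2 * hsNorm e ((∫ ω, F ω ∂P) - spectralDensity P X θ) ^ 2) ∂P := by
            refine lintegral_mono fun ω => ?_
            refine le_trans ?_ (ENNReal.add_sq_le _ _)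
            gcongr
            simpa using hsNorm_add_le e (F ω - ∫ ω, F ω ∂P)
              ((∫ ω, F ω ∂P) - spectralDensity P X θ)
        _ = 2 * ∫⁻ ω, hsNorm e (F ω - ∫ ω, F ω ∂P) ^ 2 ∂P
            + 2 * hsNorm e ((∫ ω, F ω ∂P) - spectralDensity P X θ) ^ 2 := by
            rw [lintegral_add_right _ measurable_const, lintegral_const_mul' _ _ (by simp)]
            simp
        _ ≤ 2 * ENNReal.ofReal (cv * m ^ 2) + 2 * ENNReal.ofReal (2 * cb * m) ^ 2 := by gcongr
        _ = _ := by
            have h2 : (2 : ℝ≥0∞) = ENNReal.ofReal 2 := by simp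
            rw [← ENNReal.ofReal_pow (by positivity), h2, ← ENNReal.ofReal_mul (by norm_num),
              ← ENNReal.ofReal_mul (by norm_num), ← ENNReal.ofReal_add (by positivity)
              (by positivity)]
            congr 1
            ring
    refine (ENNReal.rpow_le_rpow hmse (by norm_num)).trans_eq ?_
    rw [ENNReal.ofReal_rpow_of_nonneg (by positivity) (by norm_num), ← Real.sqrt_eq_rpow,
      Real.sqrt_mul (by positivity), Real.sqrt_sq hm0]
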